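/- Let $T>0$, let $(\Omega,\mathcal F,(\mathcal F_t)_{t\in[0,T]},\mathbb P)$ be a filtered probability space, write $\mathbb E_t=\mathbb E[\cdot\mid\mathcal F_t]$, and let $\vartheta>2$, $L\ge 0$. Let $A_t=\int_0^t I_s\,ds$, $t\in[0,T]$, where $I$ is a (jointly measurable) real process that is Markov with respect to $(\mathcal F_t)$, with $\sup_{t\in[0,T]}\|I_t\|_{L^\vartheta}<\infty$, $\|I_t-I_s\|_{L^2}\le L|t-s|^{1/2}$, and whose transition expectations $\mathbb E^{t,x}[I_r]=\mathbb E[I_r\mid I_t=x]$ have a version satisfying $$|\mathbb E^{t,x}[I_r]-\mathbb E^{s,y}[I_r]|\le L\big(|x-y|+|t-s|^{1/2}(1+|x|+|y|)\big)$$ for all $0\le t\le s\le r\le T$ and $x,y\in\mathbb R$. Let $(I^m)_{m\ge1}$ be copies of $I$ such that $I,I^1,I^2,\dots$ are mutually independent. For $N,M,K\in\{1,2,\dots\}$ and $R\ge 0$ let $t_i=iT/N$, $\mathcal T_R(x)=\max(-R,\min(x,R))$, $x_\ell=-\frac R2+\frac{\ell R}{K}$, and let $\mathcal V_K$ be the space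 of functions $\mathbb R\to\mathbb R$ that are constant on each $[x_\ell,x_{\ell+1})$, $0\le \ell<K$, and zero elsewhere. For $0\le i\le j\le N$ let $$\psi_{i,j}=\mathcal T_R\tilde\psi_{i,j},\qquad \tilde\psi_{i,j}\in\operatorname*{arg\,min}_{\psi\in\mathcal V_K}\frac1M\sum_{m=1}^M|\psi(I^m_{t_i})-\mathcal T_R(I^m_{t_j})|^2$$ be any truncated least-squares estimates, and for $0\le t\le r\le T$ put $$\mathcal I^{N,M,K,R}_{t,r}=\sum_{i,j=0}^{N-1}\psi_{i,j}(I_{t_i})\mathbf 1_{[t_i,t_{i+1})\times[t_j,t_{j+1})}(t,r).$$ Let $$\mathcal E(N,M,K,R)=\sup_{t\in[0,T]}\Big\|\sup_{s\in[t,T]}\Big|\mathbb E_t[A_s]-\Big(A_t+\int_t^s\mathcal I^{N,M,K,R}_{t,r}\,dr\Big)\Big|\Big\|_{L^2},$$ where $\mathbb E_t[A_s]$ is taken in a version that, for each $t$, is a.s. continuous in $s\in[t,T]$. Then: (1) Such versions of the conditional expectations exist. (2) There is $C\ge0$ such that for all $N,M,K\in\{1,2,\dots\}$, all $R\ge0$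 and all choices of the minimisers, $$\mathcal E(N,M,K,R)\le C\Big(\frac1{\sqrt N}+R\sqrt{\frac{(\ln M+1)K}{M}}+\frac RK+R^{-\frac{\vartheta-2}2}\Big),$$ where $R^{-(\vartheta-2)/2}=\infty$ for $R=0$. (3) Let $N_M,K_M\in\{1,2,\dots\}$ and $R_M\in(0,\infty)$, $M\ge1$, satisfy $$N_M\sim\Big(\frac M{\ln M+1}\Big)^{2/3},\quad K_M\sim\Big(\frac M{\ln M+1}\Big)^{1/3},\quad R_M\sim\Big(\frac M{\ln M+1}\Big)^{2/(3\vartheta)},$$ where $a_M\sim b_M$ means $0<\liminf_{M\to\infty} a_M/b_M\le\limsup_{M\to\infty} a_M/b_M<\infty$. Then there is $C\ge0$ (depending on these sequences) such that for all $M\ge1$ and all choices of the minimisers, $$\mathcal E(N_M,M,K_M,R_M)\le C\Big(\frac{\ln M+1}M\Big)^{\frac{\vartheta-2}{3\vartheta}}.$$ -/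

import Mathlib

open MeasureTheory ProbabilityTheory Filter Set
open scoped ENNReal Topology

namespace LSMC

variable {Ω : Type*} [mΩ : MeasurableSpace Ω]

/-- The path of a real process over the time interval `[0,T]`. Processes are indexed by `ℝ`,
only the times in `[0,T]` matter. -/
def path (T : ℝ) (X : ℝ → Ω → ℝ) (ω : Ω) : Icc (0 : ℝ) T → ℝ := fun t => X t ω

/-- `I` is a Markov process on `[0,T]` with respect to the filtration `ℱ`: it is adapted, and
`P(I_r ∈ B | ℱ_t) = P(I_r ∈ B | I_t)` a.s. for all `0 ≤ t ≤ r ≤ T` and Borel sets `B`. -/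
structure IsMarkovProcess (T : ℝ) (μ : Measure Ω) (ℱ : Filtration ℝ mΩ) (I : ℝ → Ω → ℝ) :
    Prop where
  adapted : ∀ t ∈ Icc 0 T, Measurable[ℱ t] (I t)
  markov : ∀ t ∈ Icc 0 T, ∀ r ∈ Icc t T, ∀ B : Set ℝ, MeasurableSet B →
    μ[(I r ⁻¹' B).indicator (fun _ => (1 : ℝ)) | ℱ t] =ᵐ[μ]
      μ[(I r ⁻¹' B).indicator (fun _ => (1 : ℝ)) | MeasurableSpace.comap (I t) inferInstance]

/-- `φ t r x` is a version of the transition expectation `E[I_r | I_t = x]`, `0 ≤ t ≤ r ≤ T`. -/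
def IsTransitionExpectation (T : ℝ) (μ : Measure Ω) (I : ℝ → Ω → ℝ) (φ : ℝ → ℝ → ℝ → ℝ) : Prop :=
  ∀ t ∈ Icc 0 T, ∀ r ∈ Icc t T, Measurable (φ t r) ∧
    (fun ω => φ t r (I t ω)) =ᵐ[μ] μ[I r | MeasurableSpace.comap (I t) inferInstance]

/-- The standing assumption on the signal `A` and its Markovian time derivative `I`. -/
structure IsRegularSignal (T ϑ L : ℝ) (μ : Measure Ω) (ℱ : Filtration ℝ mΩ)
    (A I : ℝ → Ω → ℝ) : Prop where
  measurable : Measurable (fun p : Icc (0 : ℝ) T × Ω => I p.1 p.2)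
  signal_eq : ∀ᵐ ω ∂μ, ∀ t ∈ Icc 0 T, A t ω = ∫ u in (0 : ℝ)..t, I u ω
  isMarkov : IsMarkovProcess T μ ℱ I
  bounded : (⨆ t ∈ Icc 0 T, eLpNorm (I t) (ENNReal.ofReal ϑ) μ) < ⊤
  holder : ∀ t ∈ Icc 0 T, ∀ s ∈ Icc t T,
    eLpNorm (I t - I s) 2 μ ≤ ENNReal.ofReal (L * |t - s| ^ (1 / 2 : ℝ))
  transition : ∃ φ : ℝ → ℝ → ℝ → ℝ, IsTransitionExpectation T μ I φ ∧
    ∀ t ∈ Icc 0 T, ∀ s ∈ Icc t T, ∀ r ∈ Icc s T, ∀ x y : ℝ,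
      |φ t r x - φ s r y| ≤ L * (|x - y| + |t - s| ^ (1 / 2 : ℝ) * (1 + |x| + |y|))

/-- `(Ic m)` are independent copies of the process `I`: each has the law of `I` on path space, and
`I, Ic 0, Ic 1, …` are mutually independent. -/
structure IsIndepCopies (T : ℝ) (μ : Measure Ω) (I : ℝ → Ω → ℝ) (Ic : ℕ → ℝ → Ω → ℝ) :
    Prop where
  measurable : ∀ m, ∀ t ∈ Icc 0 T, Measurable (Ic m t)
  identDistrib : ∀ m, IdentDistrib (path T (Ic m)) (path T I) μ μ
  indep : iIndepFun (fun k : Option ℕ => path T (k.elim I Ic)) μ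

/-- `Y t s` is the conditional expectation `E[A_s | ℱ_t]`, `0 ≤ t ≤ s ≤ T`, in a version that for
each `t` has a.s. continuous paths in `s`. -/
structure IsCondSignal (T : ℝ) (μ : Measure Ω) (ℱ : Filtration ℝ mΩ)
    (A : ℝ → Ω → ℝ) (Y : ℝ → ℝ → Ω → ℝ) : Prop where
  ae_eq : ∀ t ∈ Icc 0 T, ∀ s ∈ Icc t T, Y t s =ᵐ[μ] μ[A s | ℱ t]
  continuousOn : ∀ t ∈ Icc 0 T, ∀ᵐ ω ∂μ, ContinuousOn (fun s => Y t s ω) (Icc t T)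

/-- The truncation at level `R`. -/
def trunc (R x : ℝ) : ℝ := max (-R) (min x R)

/-- The time grid `t_i = i T / N`. -/
noncomputable def timeGrid (T : ℝ) (N i : ℕ) : ℝ := i * T / N

/-- The uniform spatial grid `x_ℓ = -R/2 + ℓ R / K` of `[-R/2, R/2]`. -/
noncomputable def spaceGrid (R : ℝ) (K ℓ : ℕ) : ℝ := -R / 2 + ℓ * R / K

/-- The space of functions that are constant on each cell `[x_ℓ, x_{ℓ+1})`, `ℓ < K`, of the spatial
grid and zero elsewhere. -/
noncomputable def piecewiseConstant (R : ℝ) (K : ℕ) : Submodule ℝ (ℝ → ℝ) :=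
  Submodule.span ℝ (range fun ℓ : Fin K =>
    (Ico (spaceGrid R K ℓ) (spaceGrid R K (ℓ + 1))).indicator fun _ => (1 : ℝ))

/-- The empirical risk `(1/M) ∑_m |ψ(x_m) - T_R(y_m)|²` over `M` samples. -/
noncomputable def empiricalRisk (M : ℕ) (R : ℝ) (x y : ℕ → ℝ) (ψ : ℝ → ℝ) : ℝ :=
  1 / (M : ℝ) * ∑ m ∈ Finset.range M, |ψ (x m) - trunc R (y m)| ^ 2

/-- `ψ` minimises the empirical risk over the vector space `V`. -/
def IsLeastSquares (V : Submodule ℝ (ℝ → ℝ)) (M : ℕ) (R : ℝ) (x y : ℕ → ℝ) (ψ : ℝ → ℝ) : Prop :=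
  ψ ∈ V ∧ ∀ χ ∈ V, empiricalRisk M R x y ψ ≤ empiricalRisk M R x y χ

/-- `ψ i j ω` is, for all `0 ≤ i ≤ j ≤ N`, a (before truncation) least-squares estimate of
`x ↦ E[I_{t_j} | I_{t_i} = x]` over the piecewise constant functions, computed from the samples
`Ic 0, …, Ic (M - 1)`. Minimisers need not be unique; any choice is allowed. -/
def IsRegression (T : ℝ) (N M K : ℕ) (R : ℝ) (Ic : ℕ → ℝ → Ω → ℝ)
    (ψ : ℕ → ℕ → Ω → ℝ → ℝ) : Prop :=
  ∀ i j, i ≤ j → j ≤ N → ∀ ω,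
    IsLeastSquares (piecewiseConstant R K) M R
      (fun m => Ic m (timeGrid T N i) ω) (fun m => Ic m (timeGrid T N j) ω) (ψ i j ω)

/-- The piecewise constant process `(t, r) ↦ ∑_{i,j<N} T_R(ψ_{i,j}(I_{t_i}))` on
`[t_i, t_{i+1}) × [t_j, t_{j+1})`. -/
noncomputable def regressionProcess (T : ℝ) (N : ℕ) (R : ℝ) (I : ℝ → Ω → ℝ)
    (ψ : ℕ → ℕ → Ω → ℝ → ℝ) (t r : ℝ) (ω : Ω) : ℝ :=
  ∑ i ∈ Finset.range N, ∑ j ∈ Finset.range N,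
    (Ico (timeGrid T N i) (timeGrid T N (i + 1)) ×ˢ
      Ico (timeGrid T N j) (timeGrid T N (j + 1))).indicator
        (fun _ => trunc R (ψ i j ω (I (timeGrid T N i) ω))) (t, r)

/-- The error
`sup_{t ∈ [0,T]} ‖ sup_{s ∈ [t,T]} | E_t[A_s] - (A_t + ∫_t^s 𝓘_{t,r} dr) | ‖_{L²}` in `[0,∞]`,
where `Y` stands for `E_t[A_s]` and `𝓘` for the regression process. -/
noncomputable def estimationError (T : ℝ) (μ : Measure Ω) (N : ℕ) (R : ℝ) (A I : ℝ → Ω → ℝ)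
    (Y : ℝ → ℝ → Ω → ℝ) (ψ : ℕ → ℕ → Ω → ℝ → ℝ) : ℝ≥0∞ :=
  ⨆ t ∈ Icc 0 T, eLpNorm (fun ω => ⨆ s ∈ Icc t T,
    ‖Y t s ω - (A t ω + ∫ r in t..s, regressionProcess T N R I ψ t r ω)‖ₑ) 2 μ

/-- `a_M ∼ b_M`: `0 < liminf a_M / b_M ≤ limsup a_M / b_M < ∞` (for positive sequences). -/
def SameOrder (a b : ℕ → ℝ) : Prop :=
  0 < liminf (fun M => ENNReal.ofReal (a M / b M)) atTop ∧
    limsup (fun M => ENNReal.ofReal (a M / b M)) atTop < ⊤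

end LSMC

namespace LSMC

/-! ### Least squares over piecewise constant functions -/

/-! The error splits into a time discretisation error, controlled by the regularity of `I`, and a
regression error at pairs of grid times, controlled by independence of the samples from the
evaluating process.

Regression. On a cell the least-squares estimate is the empirical mean of the truncated responses,
so truncating it changes nothing on occupied cells. The random number of samples in the cell is
replaced by its mean `M * p`: the difference between the estimate and the true cell average `q / p`,
multiplied by `M * p`, is a centred sum minus the estimate times another centred sum, and the
estimate is bounded by `R` (`IsLeastSquares.abs_trunc_sub_div_le`). Both sums have variance of order
`M * p`, with factors `R ^ 2` and `1`. The evaluating process is independent of the samples and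
visits the cell with probability `p`, which supplies the second factor `p` needed to cancel `(M * p)
^ 2`. Each cell thus contributes `4 * R ^ 2 / M` at most, and the `K` cells together give `R * √(K /
M)` in `L²` (`exists_statistical_majorant`). No concentration inequality is used and no logarithm
arises; the logarithm in the theorem is slack.

Bias. Inside the spatial grid, a cell average differs from the Lipschitz regression function by at
most `L * (R / K)` plus the average effect of truncating the response. Outside the grid the estimate
is zero, and the regression function itself is the error. Both tail terms are of order `R ^ (-((ϑ -
2) / 2))` by the moment of order `ϑ` (`exists_truncation_majorant`, `eLpNorm_indicator_outside_le`).

Time. Freezing `I` on each grid interval costs `√(T / N)` in `L²`, by the Hölder condition. This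
cost bounds all increments of `A` at once, and so does its conditional expectation for the
conditional increments (`IsRegularSignal.ae_abs_condSignal_sub_le`); hence the inner supremum over
`s` is harmless. The Markov property turns conditional expectations at time `t` into transition
expectations at `I t`, and their regularity allows time and state to be moved back to the last grid
time, again at cost `√(T / N)` (`IsRegularSignal.eLpNorm_condExp_sub_transition_le`).

The least-squares minimisers are arbitrary and need not depend measurably on the sample point, so
the regression error is always bounded by a measurable majorant. Adding up the contributions gives
`estimationError_le`; inserting the tuned parameters gives the rate. -/

theorem abs_trunc_le {R : ℝ} (hR : 0 ≤ R) (x : ℝ) : |trunc R x| ≤ R := by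
  unfold trunc
  rw [abs_le]
  exact ⟨le_max_left _ _, max_le (by linarith) (min_le_right _ _)⟩

theorem trunc_eq_self {R x : ℝ} (hx : |x| ≤ R) : trunc R x = x := by
  rw [abs_le] at hx
  unfold trunc
  rw [min_eq_left hx.2, max_eq_right hx.1]

theorem measurable_trunc (R : ℝ) : Measurable (trunc R) := by
  unfold trunc
  fun_prop

theorem abs_trunc_sub_le {R : ℝ} (hR : 0 ≤ R) (x : ℝ) : |trunc R x - x| ≤ |x| := by
  unfold trunc
  rcases le_total x R with h | h <;> rcases le_total (-R) x with h' | h'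
  · simp [h, h']
  · rw [min_eq_left h, max_eq_left h', abs_le]
    have := neg_le_abs x
    constructor <;> linarith [abs_nonneg x]
  · rw [min_eq_right h, max_eq_right (by linarith), abs_le]
    have := le_abs_self x
    constructor <;> linarith [abs_nonneg x]
  · have : R = 0 := by linarith
    have : x = 0 := by linarith
    simp [*]

/-- The `ℓ`-th cell of the spatial grid. -/
def cell (R : ℝ) (K ℓ : ℕ) : Set ℝ := Ico (spaceGrid R K ℓ) (spaceGrid R K (ℓ + 1))

theorem measurableSet_cell (R : ℝ) (K ℓ : ℕ) : MeasurableSet (cell R K ℓ) := measurableSet_Ico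

theorem monotone_spaceGrid {R : ℝ} (hR : 0 ≤ R) (K : ℕ) : Monotone (spaceGrid R K) := by
  intro a b hab
  unfold spaceGrid
  gcongr

theorem pairwise_disjoint_cell {R : ℝ} (hR : 0 ≤ R) (K : ℕ) :
    Pairwise (Function.onFun Disjoint (cell R K)) := by
  exact (monotone_spaceGrid hR K).pairwise_disjoint_on_Ico_succ

theorem exists_mem_cell {R : ℝ} {K : ℕ} (hK : 0 < K) {x : ℝ} (h1 : -(R / 2) ≤ x)
    (h2 : x < R / 2) : ∃ ℓ : Fin K, x ∈ cell R K ℓ := by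
  have hR : 0 < R := by linarith
  have hK' : (0 : ℝ) < K := by exact_mod_cast hK
  have hy : 0 ≤ (x + R / 2) * K / R := by
    have : 0 ≤ x + R / 2 := by linarith
    positivity
  have hyK : (x + R / 2) * K / R < K := by
    rw [div_lt_iff₀ hR]
    nlinarith
  have hlt : ⌊(x + R / 2) * K / R⌋₊ < K := (Nat.floor_lt hy).2 hyK
  refine ⟨⟨_, hlt⟩, ?_⟩
  have e1 := Nat.floor_le hy
  have e2 := Nat.lt_floor_add_one ((x + R / 2) * K / R)
  rw [le_div_iff₀ hR] at e1
  rw [div_lt_iff₀ hR] at e2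
  constructor
  · unfold spaceGrid
    rw [← le_sub_iff_add_le', div_le_iff₀ hK']
    simpa [sub_div, neg_div] using e1
  · unfold spaceGrid
    rw [← sub_lt_iff_lt_add', lt_div_iff₀ hK']
    push_cast
    simpa [sub_div, neg_div] using e2

theorem exists_eq_sum_of_mem_piecewiseConstant {R : ℝ} {K : ℕ} {ψ : ℝ → ℝ}
    (hψ : ψ ∈ piecewiseConstant R K) :
    ∃ a : Fin K → ℝ, ∀ x, ψ x = ∑ ℓ : Fin K, a ℓ * (cell R K ℓ).indicator (fun _ => 1) x := by
  obtain ⟨a, ha⟩ := (Submodule.mem_span_range_iff_exists_fun ℝ).1 hψ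
  refine ⟨a, fun x => ?_⟩
  rw [← ha]
  simp [Finset.sum_apply, cell]

theorem exists_const_on_cell {R : ℝ} (hR : 0 ≤ R) {K : ℕ} {ψ : ℝ → ℝ}
    (hψ : ψ ∈ piecewiseConstant R K) (ℓ : Fin K) : ∃ a, ∀ x ∈ cell R K ℓ, ψ x = a := by
  obtain ⟨a, ha⟩ := exists_eq_sum_of_mem_piecewiseConstant hψ
  refine ⟨a ℓ, fun x hx => ?_⟩
  rw [ha, Finset.sum_eq_single ℓ]
  · simp [hx]
  · intro k _ hk
    have hd := pairwise_disjoint_cell hR K (i := (k : ℕ)) (j := ℓ) (by simpa [Fin.ext_iff] using hk)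
    have : x ∉ cell R K k := fun h => Set.disjoint_left.1 hd h hx
    simp [this]
  · simp

theorem eq_zero_of_notMem_cell {R : ℝ} {K : ℕ} {ψ : ℝ → ℝ}
    (hψ : ψ ∈ piecewiseConstant R K) {x : ℝ} (hx : ∀ ℓ : Fin K, x ∉ cell R K ℓ) : ψ x = 0 := by
  obtain ⟨a, ha⟩ := exists_eq_sum_of_mem_piecewiseConstant hψ
  rw [ha]
  exact Finset.sum_eq_zero fun ℓ _ => by simp [hx ℓ]

/-- A parabola through the origin that stays nonnegative has zero slope there. The test point `-b /
(n + 1)` has `n + 1` in place of `n` so that `n = 0` needs no separate treatment. -/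
theorem eq_zero_of_forall_quadratic_nonneg {b n : ℝ} (hn : 0 ≤ n)
    (h : ∀ ε : ℝ, 0 ≤ 2 * ε * b + ε ^ 2 * n) : b = 0 := by
  have h1 := h (-b / (n + 1))
  have hn1 : 0 < n + 1 := by linarith
  have e : 2 * (-b / (n + 1)) * b + (-b / (n + 1)) ^ 2 * n = -(b ^ 2 * (n + 2) / (n + 1) ^ 2) := by
    field_simp
    ring
  rw [e] at h1
  by_contra hb
  have : 0 < b ^ 2 * (n + 2) / (n + 1) ^ 2 := by positivity
  linarith

/-- The normal equation of a least-squares estimate in direction `g`. -/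
theorem IsLeastSquares.sum_mul_eq_zero {V : Submodule ℝ (ℝ → ℝ)} {M : ℕ} {R : ℝ} {x y : ℕ → ℝ}
    {ψ : ℝ → ℝ} (hM : 0 < M) (h : IsLeastSquares V M R x y ψ) {g : ℝ → ℝ} (hg : g ∈ V) :
    ∑ m ∈ Finset.range M, (ψ (x m) - trunc R (y m)) * g (x m) = 0 := by
  refine eq_zero_of_forall_quadratic_nonneg (n := ∑ m ∈ Finset.range M, g (x m) ^ 2)
    (Finset.sum_nonneg fun _ _ => sq_nonneg _) fun ε => ?_
  have h1 := h.2 (ψ + ε • g) (V.add_mem h.1 (V.smul_mem ε hg))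
  unfold empiricalRisk at h1
  have hM' : (0 : ℝ) < 1 / M := by positivity
  rw [mul_le_mul_iff_right₀ hM', ← sub_nonneg, ← Finset.sum_sub_distrib] at h1
  refine h1.trans_eq ?_
  rw [Finset.mul_sum, Finset.mul_sum, ← Finset.sum_add_distrib]
  refine Finset.sum_congr rfl fun m _ => ?_
  simp only [Pi.add_apply, Pi.smul_apply, smul_eq_mul, sq_abs]
  ring

theorem indicator_cell_mem_piecewiseConstant (R : ℝ) {K : ℕ} (ℓ : Fin K) :
    (cell R K ℓ).indicator (fun _ => (1 : ℝ)) ∈ piecewiseConstant R K :=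
  Submodule.subset_span ⟨ℓ, rfl⟩

/-- On each cell, the truncated least-squares estimate is an average of the truncated samples. -/
theorem IsLeastSquares.card_mul_trunc_eq {R : ℝ} (hR : 0 ≤ R) {K M : ℕ} (hM : 0 < M)
    {x y : ℕ → ℝ} {ψ : ℝ → ℝ} (h : IsLeastSquares (piecewiseConstant R K) M R x y ψ) (ℓ : Fin K)
    {z : ℝ} (hz : z ∈ cell R K ℓ) :
    (∑ m ∈ Finset.range M, (cell R K ℓ).indicator (fun _ => (1 : ℝ)) (x m)) * trunc R (ψ z) =
      ∑ m ∈ Finset.range M, (cell R K ℓ).indicator (fun _ => (1 : ℝ)) (x m) * trunc R (y m) := by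
  set e := (cell R K ℓ).indicator (fun _ => (1 : ℝ)) with he
  have he0 : ∀ x, 0 ≤ e x := fun x => Set.indicator_nonneg (fun _ _ => zero_le_one) x
  obtain ⟨a, ha⟩ := exists_const_on_cell hR h.1 ℓ
  have h1 := h.sum_mul_eq_zero hM (indicator_cell_mem_piecewiseConstant R ℓ)
  have h2 : (∑ m ∈ Finset.range M, e (x m)) * a = ∑ m ∈ Finset.range M, e (x m) * trunc R (y m) := by
    rw [← sub_eq_zero, ← h1, Finset.sum_mul, ← Finset.sum_sub_distrib]
    refine Finset.sum_congr rfl fun m _ => ?_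
    by_cases hm : x m ∈ cell R K ℓ
    · simp [he, hm, ha _ hm]
    · simp [he, hm]
  rw [ha z hz]
  have h3 : |∑ m ∈ Finset.range M, e (x m) * trunc R (y m)| ≤
      (∑ m ∈ Finset.range M, e (x m)) * R := by
    rw [Finset.sum_mul]
    refine (Finset.abs_sum_le_sum_abs _ _).trans (Finset.sum_le_sum fun m _ => ?_)
    rw [abs_mul, abs_of_nonneg (he0 _)]
    exact mul_le_mul_of_nonneg_left (abs_trunc_le hR _) (he0 _)
  have hn : 0 ≤ ∑ m ∈ Finset.range M, e (x m) := Finset.sum_nonneg fun _ _ => he0 _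
  -- An empty cell makes both sides zero. On an occupied cell the constant is an average of numbers
  -- in `[-R, R]`, so the outer truncation does not act.
  rcases hn.eq_or_lt with h0 | h0
  · rw [← h0] at h3 h2 ⊢
    rw [← h2]
    simp
  · rw [trunc_eq_self, h2]
    rw [← h2, abs_mul, abs_of_pos h0] at h3
    exact le_of_mul_le_mul_left h3 h0

/-- Deviation of the truncated estimate on a cell of probability `p` from `q / p`, in terms of the
fluctuations of the empirical means. -/
theorem IsLeastSquares.abs_trunc_sub_div_le {R : ℝ} (hR : 0 ≤ R) {K M : ℕ} (hM : 0 < M)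
    {x y : ℕ → ℝ} {ψ : ℝ → ℝ} (h : IsLeastSquares (piecewiseConstant R K) M R x y ψ) (ℓ : Fin K)
    {z p q : ℝ} (hp : 0 < p) (hz : z ∈ cell R K ℓ) :
    |trunc R (ψ z) - q / p| ≤
      (|∑ m ∈ Finset.range M, ((cell R K ℓ).indicator (fun _ => (1 : ℝ)) (x m) * trunc R (y m) - q)|
        + R * |∑ m ∈ Finset.range M, ((cell R K ℓ).indicator (fun _ => (1 : ℝ)) (x m) - p)|)
        / (M * p) := by
  have h1 := h.card_mul_trunc_eq hR hM ℓ hz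
  have hM' : (0 : ℝ) < M := by exact_mod_cast hM
  have hMp : 0 < M * p := by positivity
  have h2 : |trunc R (ψ z) - q / p| * (M * p) = |(trunc R (ψ z) - q / p) * (M * p)| := by
    rw [abs_mul, abs_of_pos hMp]
  rw [le_div_iff₀ hMp, h2]
  -- Adding and subtracting the estimate times the sample count replaces the random denominator by
  -- `M * p`; the price is the fluctuation of the count, weighted by an estimate of size at most
  -- `R`.
  have e : (trunc R (ψ z) - q / p) * (M * p) =
      ∑ m ∈ Finset.range M, ((cell R K ℓ).indicator (fun _ => (1 : ℝ)) (x m) * trunc R (y m) - q)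
        - trunc R (ψ z) *
          ∑ m ∈ Finset.range M, ((cell R K ℓ).indicator (fun _ => (1 : ℝ)) (x m) - p) := by
    rw [Finset.sum_sub_distrib, Finset.sum_sub_distrib, ← h1]
    simp
    field_simp
    ring
  rw [e]
  refine (abs_sub _ _).trans (add_le_add_right ?_ _)
  rw [abs_mul]
  exact mul_le_mul_of_nonneg_right (abs_trunc_le hR _) (abs_nonneg _)

end LSMC

namespace LSMC

variable {Ω : Type*} [mΩ : MeasurableSpace Ω]

/-! ### Regression error on independent copies -/

theorem eLpNorm_sqrt_le {μ : Measure Ω} {F : Ω → ℝ} (hF0 : ∀ ω, 0 ≤ F ω) (hF : Integrable F μ)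
    {c : ℝ} (hc : 0 ≤ c) (h : ∫ ω, F ω ∂μ ≤ c ^ 2) :
    eLpNorm (fun ω => √(F ω)) 2 μ ≤ ENNReal.ofReal c := by
  rw [eLpNorm_eq_lintegral_rpow_enorm_toReal (by simp) (by simp)]
  have e : ∀ ω, ‖√(F ω)‖ₑ ^ (2 : ℝ≥0∞).toReal = ENNReal.ofReal (F ω) := fun ω => by
    rw [Real.enorm_of_nonneg (Real.sqrt_nonneg _), ENNReal.toReal_ofNat,
      ENNReal.ofReal_rpow_of_nonneg (Real.sqrt_nonneg _) (by norm_num), Real.rpow_two,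
      Real.sq_sqrt (hF0 ω)]
  simp_rw [e]
  rw [← ofReal_integral_eq_lintegral_ofReal hF (ae_of_all _ hF0),
    ENNReal.ofReal_rpow_of_nonneg (integral_nonneg hF0) (by simp)]
  refine ENNReal.ofReal_le_ofReal ?_
  rw [ENNReal.toReal_ofNat, ← Real.sqrt_eq_rpow]
  exact Real.sqrt_le_iff.2 ⟨hc, h⟩

theorem eLpNorm_add_le_ofReal {μ : Measure Ω} {f g : Ω → ℝ} {a b : ℝ}
    (hf : AEStronglyMeasurable f μ) (hg : AEStronglyMeasurable g μ) (ha : 0 ≤ a) (hb : 0 ≤ b)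
    (hfa : eLpNorm f 2 μ ≤ ENNReal.ofReal a) (hgb : eLpNorm g 2 μ ≤ ENNReal.ofReal b) :
    eLpNorm (fun ω => f ω + g ω) 2 μ ≤ ENNReal.ofReal (a + b) := by
  rw [ENNReal.ofReal_add ha hb]
  exact (eLpNorm_add_le hf hg (by norm_num)).trans (add_le_add hfa hgb)

theorem eLpNorm_const_le_ofReal {μ : Measure Ω} [IsProbabilityMeasure μ] {c : ℝ} (hc : 0 ≤ c) :
    eLpNorm (fun _ : Ω => c) 2 μ ≤ ENNReal.ofReal c := by
  rw [eLpNorm_const _ (by norm_num) (NeZero.ne μ)]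
  simp [Real.enorm_of_nonneg hc]

theorem eLpNorm_abs (μ : Measure Ω) (f : Ω → ℝ) (p : ℝ≥0∞) :
    eLpNorm (fun ω => |f ω|) p μ = eLpNorm f p μ :=
  eLpNorm_norm f

/-- The index `none` stands for the evaluating process and `some m` for the samples. Functions of
disjoint finite families of independent variables are independent. -/
theorem indepFun_none_sum {μ : Measure Ω} {P : Option ℕ → Ω → ℝ × ℝ} (hm : ∀ k, Measurable (P k)) (hi : iIndepFun P μ)
    {f g : ℝ × ℝ → ℝ} (hf : Measurable f) (hg : Measurable g) (M : ℕ) :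
    IndepFun (fun ω => f (P none ω)) (fun ω => (∑ m ∈ Finset.range M, g (P (some m) ω)) ^ 2) μ := by
  have hd : Disjoint ({none} : Finset (Option ℕ)) ((Finset.range M).map .some) := by simp
  have h := hi.indepFun_finset _ _ hd hm
  have hφ : Measurable fun v : ({none} : Finset (Option ℕ)) → ℝ × ℝ =>
      f (v ⟨none, Finset.mem_singleton_self none⟩) := hf.comp (measurable_pi_apply _)
  have hψ : Measurable fun v : (Finset.range M).map Function.Embedding.some → ℝ × ℝ => (∑ i, g (v i)) ^ 2 :=
    (Finset.measurable_sum _ fun i _ => hg.comp (measurable_pi_apply i)).pow_const 2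
  have h2 := h.comp hφ hψ
  have hs : ∀ ω, ∑ i : (Finset.range M).map Function.Embedding.some, g (P i ω) =
      ∑ m ∈ Finset.range M, g (P (some m) ω) := fun ω => by
    rw [Finset.sum_coe_sort ((Finset.range M).map Function.Embedding.some) fun k => g (P k ω),
      Finset.sum_map]
    rfl
  have h3 : (fun ω => (∑ m ∈ Finset.range M, g (P (some m) ω)) ^ 2) =
      fun ω => (∑ i : (Finset.range M).map Function.Embedding.some, g (P i ω)) ^ 2 := by
    ext ω
    rw [hs]
  rw [h3]
  exact h2

section Copies

variable {μ : Measure Ω} [IsProbabilityMeasure μ] {P : Option ℕ → Ω → ℝ × ℝ}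

/-- The square of the probability is the point: one factor is the variance of a variable supported
in `B`, the other is the independent event that the evaluating process lies in `B`. -/
theorem integral_indicator_mul_sq_sum_le (hm : ∀ k, Measurable (P k)) (hi : iIndepFun P μ)
    (hid : ∀ m, IdentDistrib (P (some m)) (P none) μ μ) {B : Set (ℝ × ℝ)} (hB : MeasurableSet B)
    {G : ℝ × ℝ → ℝ} (hG : Measurable G) {c : ℝ}
    (hGc : ∀ z, |G z| ≤ c * B.indicator (fun _ => 1) z) (M : ℕ) :
    Integrable (fun ω => B.indicator (fun _ => (1 : ℝ)) (P none ω) *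
      (∑ m ∈ Finset.range M, (G (P (some m) ω) - ∫ ω, G (P none ω) ∂μ)) ^ 2) μ ∧
    ∫ ω, B.indicator (fun _ => (1 : ℝ)) (P none ω) *
      (∑ m ∈ Finset.range M, (G (P (some m) ω) - ∫ ω, G (P none ω) ∂μ)) ^ 2 ∂μ ≤
      M * c ^ 2 * μ.real (P none ⁻¹' B) ^ 2 := by
  set q := ∫ ω, G (P none ω) ∂μ with hq
  have hBm : Measurable (B.indicator (fun _ => (1 : ℝ))) := measurable_const.indicator hB
  have hGb : ∀ z, ‖G z‖ ≤ |c| := fun z => by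
    refine (hGc z).trans ?_
    by_cases hz : z ∈ B
    · simpa [hz] using le_abs_self c
    · simp [hz]
  have hL : ∀ k, MemLp (fun ω => G (P k ω)) 2 μ := fun k =>
    MemLp.of_bound (hG.comp (hm k)).aestronglyMeasurable |c| (ae_of_all _ fun ω => hGb _)
  have hmean : ∀ m, ∫ ω, G (P (some m) ω) ∂μ = q := fun m => ((hid m).comp hG).integral_eq
  have hpB : ∫ ω, B.indicator (fun _ => (1 : ℝ)) (P none ω) ∂μ = μ.real (P none ⁻¹' B) := by
    have : (fun ω => B.indicator (fun _ => (1 : ℝ)) (P none ω)) =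
      (P none ⁻¹' B).indicator (fun _ => 1) := by
      ext ω
      by_cases hz : P none ω ∈ B <;> simp [hz]
    rw [this, integral_indicator (hm none hB)]
    simp
  have hsq : ∀ k, ∫ ω, (G (P k ω)) ^ 2 ∂μ = ∫ ω, (G (P none ω)) ^ 2 ∂μ := by
    intro k
    cases k with
    | none => rfl
    | some m => exact ((hid m).comp (hG.pow_const 2)).integral_eq
  have hsq2 : ∫ ω, (G (P none ω)) ^ 2 ∂μ ≤ c ^ 2 * μ.real (P none ⁻¹' B) := by
    rw [← hpB, ← integral_const_mul]
    refine integral_mono (hL none).integrable_sq ?_ fun ω => ?_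
    · refine Integrable.const_mul ?_ _
      refine Integrable.of_bound (hBm.comp (hm none)).aestronglyMeasurable 1 (ae_of_all _ fun ω => ?_)
      by_cases hz : P none ω ∈ B <;> simp [hz]
    · dsimp only
      have h1 := hGc (P none ω)
      rw [← sq_abs]
      refine (pow_le_pow_left₀ (abs_nonneg _) h1 2).trans_eq ?_
      by_cases hz : P none ω ∈ B <;> simp [hz]
  have hsum : ∀ ω, ∑ m ∈ Finset.range M, (G (P (some m) ω) - q) =
      (∑ m ∈ Finset.range M, G (P (some m) ω)) - ∫ ω, (∑ m ∈ Finset.range M, G (P (some m) ω)) ∂μ := by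
    intro ω
    rw [integral_finsetSum _ fun m _ => (hL (some m)).integrable (by norm_num), Finset.sum_sub_distrib]
    simp_rw [hmean]
  have hLs : MemLp (fun ω => ∑ m ∈ Finset.range M, G (P (some m) ω)) 2 μ :=
    memLp_finsetSum _ fun m _ => hL (some m)
  have hVar : ∫ ω, (∑ m ∈ Finset.range M, (G (P (some m) ω) - q)) ^ 2 ∂μ ≤
      M * (c ^ 2 * μ.real (P none ⁻¹' B)) := by
    simp_rw [hsum]
    rw [← variance_eq_integral hLs.aestronglyMeasurable.aemeasurable]
    have hX : (fun ω => ∑ m ∈ Finset.range M, G (P (some m) ω)) =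
      ∑ m ∈ Finset.range M, fun ω => G (P (some m) ω) := by
      ext ω; simp
    rw [hX, IndepFun.variance_sum (fun m _ => hL (some m))]
    · refine (Finset.sum_le_card_nsmul _ _ (c ^ 2 * μ.real (P none ⁻¹' B)) fun m _ => ?_).trans_eq
        (by simp)
      refine (variance_le_expectation_sq (hL (some m)).aestronglyMeasurable).trans ?_
      refine le_trans (le_of_eq ?_) hsq2
      exact hsq (some m)
    · intro a _ b _ hab
      exact (hi.indepFun (by simpa using hab : some a ≠ some b)).comp hG hG
  have hind := indepFun_none_sum hm hi hBm (hG.sub_const q) M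
  have hi1 : Integrable (fun ω => B.indicator (fun _ => (1 : ℝ)) (P none ω)) μ := by
    refine Integrable.of_bound (hBm.comp (hm none)).aestronglyMeasurable 1 (ae_of_all _ fun ω => ?_)
    by_cases hz : P none ω ∈ B <;> simp [hz]
  have hi2 : Integrable (fun ω => (∑ m ∈ Finset.range M, (G (P (some m) ω) - q)) ^ 2) μ := by
    refine MemLp.integrable_sq ?_
    exact memLp_finsetSum _ fun m _ => (hL (some m)).sub (memLp_const q)
  refine ⟨hind.integrable_mul hi1 hi2, ?_⟩
  have := hind.integral_mul_eq_mul_integral hi1.aestronglyMeasurable hi2.aestronglyMeasurable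
  refine (le_of_eq this).trans ?_
  rw [hpB]
  refine (mul_le_mul_of_nonneg_left hVar measureReal_nonneg).trans_eq ?_
  ring

end Copies

theorem measurable_indicator_cell (R : ℝ) (K ℓ : ℕ) :
    Measurable ((cell R K ℓ).indicator fun _ => (1 : ℝ)) :=
  measurable_const.indicator measurableSet_Ico

theorem sum_indicator_cell_le_one {R : ℝ} (hR : 0 ≤ R) (K : ℕ) (x : ℝ) :
    ∑ ℓ : Fin K, (cell R K ℓ).indicator (fun _ => (1 : ℝ)) x ≤ 1 := by
  by_cases h : ∃ ℓ : Fin K, x ∈ cell R K ℓ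
  · obtain ⟨ℓ, hℓ⟩ := h
    rw [Finset.sum_eq_single ℓ]
    · simp [hℓ]
    · intro k _ hk
      have hd := pairwise_disjoint_cell hR K (i := (k : ℕ)) (j := ℓ)
        (by simpa [Fin.ext_iff] using hk)
      have : x ∉ cell R K k := fun h => Set.disjoint_left.1 hd h hℓ
      simp [this]
    · simp
  · push Not at h
    rw [Finset.sum_eq_zero fun ℓ _ => by simp [h ℓ]]
    exact zero_le_one

section Copies

variable {μ : Measure Ω} [IsProbabilityMeasure μ] {P : Option ℕ → Ω → ℝ × ℝ}

/-- The statistical error of the truncated least-squares estimate. -/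
theorem exists_statistical_majorant (hm : ∀ k, Measurable (P k)) (hi : iIndepFun P μ)
    (hid : ∀ m, IdentDistrib (P (some m)) (P none) μ μ) {R : ℝ} (hR : 0 ≤ R) {K M : ℕ}
    (hM : 0 < M) {ψ : Ω → ℝ → ℝ}
    (hψ : ∀ ω, IsLeastSquares (piecewiseConstant R K) M R (fun m => (P (some m) ω).1)
      (fun m => (P (some m) ω).2) (ψ ω)) :
    ∃ H : Ω → ℝ, AEStronglyMeasurable H μ ∧ (∀ ω, 0 ≤ H ω) ∧
      eLpNorm H 2 μ ≤ ENNReal.ofReal (2 * R * √(K / M)) ∧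
      ∀ (ω) (ℓ : Fin K), (P none ω).1 ∈ cell R K ℓ →
        0 < μ.real ((fun ω => (P none ω).1) ⁻¹' cell R K ℓ) →
        |trunc R (ψ ω (P none ω).1) -
          (∫ ω, (cell R K ℓ).indicator (fun _ => (1 : ℝ)) (P none ω).1 * trunc R (P none ω).2 ∂μ) /
            μ.real ((fun ω => (P none ω).1) ⁻¹' cell R K ℓ)| ≤ H ω := by
  set e : Fin K → ℝ → ℝ := fun ℓ => (cell R K ℓ).indicator fun _ => (1 : ℝ) with he
  have hem : ∀ ℓ, Measurable (e ℓ) := fun ℓ => measurable_indicator_cell R K ℓ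
  have he0 : ∀ ℓ x, 0 ≤ e ℓ x := fun ℓ x => Set.indicator_nonneg (fun _ _ => zero_le_one) x
  set p : Fin K → ℝ := fun ℓ => μ.real ((fun ω => (P none ω).1) ⁻¹' cell R K ℓ) with hp
  have hp0 : ∀ ℓ, 0 ≤ p ℓ := fun ℓ => measureReal_nonneg
  set q : Fin K → ℝ := fun ℓ => ∫ ω, e ℓ (P none ω).1 * trunc R (P none ω).2 ∂μ with hq
  set S : Fin K → Ω → ℝ := fun ℓ ω => ∑ m ∈ Finset.range M,
    (e ℓ (P (some m) ω).1 * trunc R (P (some m) ω).2 - q ℓ) with hS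
  set D : Fin K → Ω → ℝ := fun ℓ ω => ∑ m ∈ Finset.range M, (e ℓ (P (some m) ω).1 - p ℓ) with hD
  set W : Fin K → Ω → ℝ := fun ℓ ω => (|S ℓ ω| + R * |D ℓ ω|) / (M * p ℓ) with hW
  have hpint : ∀ ℓ, ∫ ω, e ℓ (P none ω).1 ∂μ = p ℓ := fun ℓ => by
    have : (fun ω => e ℓ (P none ω).1) =
      ((fun ω => (P none ω).1) ⁻¹' cell R K ℓ).indicator (fun _ => 1) := by
      ext ω
      by_cases hz : (P none ω).1 ∈ cell R K ℓ <;> simp [he, hz]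
    rw [this, integral_indicator ((hm none).fst (measurableSet_cell R K ℓ))]
    simp [hp]
  have hmS : ∀ ℓ, Measurable (S ℓ) := fun ℓ => by
    refine Finset.measurable_sum _ fun m _ => ?_
    exact (((hem ℓ).comp (hm _).fst).mul ((measurable_trunc R).comp (hm _).snd)).sub_const _
  have hmD : ∀ ℓ, Measurable (D ℓ) := fun ℓ => by
    refine Finset.measurable_sum _ fun m _ => ?_
    exact ((hem ℓ).comp (hm _).fst).sub_const _
  have hmW : ∀ ℓ, Measurable (W ℓ) := fun ℓ => by
    have h1 := (hmS ℓ).abs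
    have h2 := (hmD ℓ).abs
    exact (h1.add (h2.const_mul R)).div_const _
  have hcellm : ∀ ℓ : Fin K, MeasurableSet (cell R K ℓ ×ˢ (univ : Set ℝ)) := fun ℓ =>
    (measurableSet_cell R K ℓ).prod MeasurableSet.univ
  have hBe : ∀ (ℓ : Fin K) (z : ℝ × ℝ),
      (cell R K ℓ ×ˢ (univ : Set ℝ)).indicator (fun _ => (1 : ℝ)) z = e ℓ z.1 := fun ℓ z => by
    by_cases hz : z.1 ∈ cell R K ℓ <;> simp [he, hz]
  have hpre : ∀ ℓ : Fin K, μ.real (P none ⁻¹' (cell R K ℓ ×ˢ (univ : Set ℝ))) = p ℓ := fun ℓ => by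
    have : P none ⁻¹' (cell R K ℓ ×ˢ (univ : Set ℝ)) = (fun ω => (P none ω).1) ⁻¹' cell R K ℓ := by
      ext ω; simp
    rw [this]
  have hbS : ∀ ℓ, Integrable (fun ω => e ℓ (P none ω).1 * S ℓ ω ^ 2) μ ∧
      ∫ ω, e ℓ (P none ω).1 * S ℓ ω ^ 2 ∂μ ≤ M * R ^ 2 * p ℓ ^ 2 := fun ℓ => by
    have := integral_indicator_mul_sq_sum_le hm hi hid (hcellm ℓ)
      (G := fun z => e ℓ z.1 * trunc R z.2) (c := R)
      (((hem ℓ).comp measurable_fst).mul ((measurable_trunc R).comp measurable_snd))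
      (fun z => by
        rw [hBe, abs_mul, abs_of_nonneg (he0 _ _), mul_comm]
        exact mul_le_mul_of_nonneg_right (abs_trunc_le hR _) (he0 _ _)) M
    simp_rw [hBe, hpre] at this
    exact this
  have hbD : ∀ ℓ, Integrable (fun ω => e ℓ (P none ω).1 * D ℓ ω ^ 2) μ ∧
      ∫ ω, e ℓ (P none ω).1 * D ℓ ω ^ 2 ∂μ ≤ M * 1 ^ 2 * p ℓ ^ 2 := fun ℓ => by
    have := integral_indicator_mul_sq_sum_le hm hi hid (hcellm ℓ)
      (G := fun z => e ℓ z.1) (c := 1) ((hem ℓ).comp measurable_fst)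
      (fun z => by rw [hBe, abs_of_nonneg (he0 _ _), one_mul]) M
    simp_rw [hBe, hpre, hpint] at this
    exact this
  have hWle : ∀ ℓ ω, e ℓ (P none ω).1 * W ℓ ω ^ 2 ≤
      (2 * (e ℓ (P none ω).1 * S ℓ ω ^ 2) + 2 * R ^ 2 * (e ℓ (P none ω).1 * D ℓ ω ^ 2)) /
        (M * p ℓ) ^ 2 := fun ℓ ω => by
    simp only [hW]
    rw [div_pow, ← mul_div_assoc]
    refine div_le_div_of_nonneg_right ?_ (sq_nonneg _)
    have h1 : (|S ℓ ω| + R * |D ℓ ω|) ^ 2 ≤ 2 * S ℓ ω ^ 2 + 2 * R ^ 2 * D ℓ ω ^ 2 := by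
      rw [← sq_abs (S ℓ ω), ← sq_abs (D ℓ ω)]
      nlinarith [sq_nonneg (|S ℓ ω| - R * |D ℓ ω|)]
    nlinarith [mul_le_mul_of_nonneg_left h1 (he0 ℓ (P none ω).1)]
  have hWint' : ∀ ℓ, Integrable (fun ω => (2 * (e ℓ (P none ω).1 * S ℓ ω ^ 2) +
      2 * R ^ 2 * (e ℓ (P none ω).1 * D ℓ ω ^ 2)) / (M * p ℓ) ^ 2) μ := fun ℓ =>
    (((hbS ℓ).1.const_mul _).add ((hbD ℓ).1.const_mul _)).div_const _
  have hWint : ∀ ℓ, Integrable (fun ω => e ℓ (P none ω).1 * W ℓ ω ^ 2) μ := fun ℓ => by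
    refine (hWint' ℓ).mono'
      ((((hem ℓ).comp (hm none).fst).mul ((hmW ℓ).pow_const 2)).aestronglyMeasurable)
      (ae_of_all _ fun ω => ?_)
    rw [Real.norm_of_nonneg (mul_nonneg (he0 _ _) (sq_nonneg _))]
    exact hWle ℓ ω
  have hM' : (0 : ℝ) < M := by exact_mod_cast hM
  have hWb : ∀ ℓ, ∫ ω, e ℓ (P none ω).1 * W ℓ ω ^ 2 ∂μ ≤ 4 * R ^ 2 / M := fun ℓ => by
    -- On a null cell `W ℓ` vanishes, since division by zero gives zero.
    rcases (hp0 ℓ).eq_or_lt with h0 | h0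
    · have : ∀ ω, e ℓ (P none ω).1 * W ℓ ω ^ 2 = 0 := fun ω => by simp [hW, ← h0]
      simp_rw [this]
      simp only [integral_zero]
      positivity
    · refine (integral_mono (hWint ℓ) (hWint' ℓ) (hWle ℓ)).trans ?_
      rw [integral_div, integral_add ((hbS ℓ).1.const_mul _) ((hbD ℓ).1.const_mul _),
        integral_const_mul, integral_const_mul, div_le_iff₀ (by positivity)]
      have h1 := (hbS ℓ).2
      have h2 := mul_le_mul_of_nonneg_left (hbD ℓ).2 (sq_nonneg R)
      have h3 : 4 * R ^ 2 / M * (M * p ℓ) ^ 2 = 4 * (M * R ^ 2 * p ℓ ^ 2) := by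
        field_simp
      rw [h3]
      nlinarith
  have hF0 : ∀ ω, 0 ≤ ∑ ℓ, e ℓ (P none ω).1 * W ℓ ω ^ 2 := fun ω =>
    Finset.sum_nonneg fun ℓ _ => mul_nonneg (he0 _ _) (sq_nonneg _)
  -- Cells are disjoint, so at most one summand is nonzero and the root equals `W ℓ` on the cell
  -- that is visited. Written as a sum over cells, its second moment is at most `K` times the bound
  -- for one cell.
  refine ⟨fun ω => √(∑ ℓ, e ℓ (P none ω).1 * W ℓ ω ^ 2), ?_, fun _ => Real.sqrt_nonneg _, ?_, ?_⟩
  · refine (Measurable.sqrt ?_).aestronglyMeasurable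
    refine Finset.measurable_sum _ fun ℓ _ => ?_
    exact ((hem ℓ).comp (hm none).fst).mul ((hmW ℓ).pow_const 2)
  · refine eLpNorm_sqrt_le hF0 (integrable_finsetSum _ fun ℓ _ => hWint ℓ) (by positivity) ?_
    rw [integral_finsetSum _ fun ℓ _ => hWint ℓ]
    refine (Finset.sum_le_card_nsmul _ _ _ fun ℓ _ => hWb ℓ).trans_eq ?_
    rw [mul_pow, Real.sq_sqrt (by positivity)]
    simp
    ring
  · intro ω ℓ hω hpℓ
    refine ((hψ ω).abs_trunc_sub_div_le hR hM ℓ (q := q ℓ) hpℓ hω).trans ?_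
    refine Real.le_sqrt_of_sq_le ?_
    refine le_trans (le_of_eq ?_) (Finset.single_le_sum (f := fun ℓ => e ℓ (P none ω).1 * W ℓ ω ^ 2)
      (fun k _ => mul_nonneg (he0 _ _) (sq_nonneg _)) (Finset.mem_univ ℓ))
    simp only [hW, hS, hD]
    simp [he, hω]
    rfl

end Copies

end LSMC

namespace LSMC

variable {Ω : Type*} [mΩ : MeasurableSpace Ω]

/-! ### Bias and truncation errors -/

/-- Beyond the level `R` the excess power `ϑ - 2` is traded for a negative power of `R`. This is the
source of every `R ^ (2 - ϑ)` in the tail estimates. -/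
theorem sq_le_rpow_mul_of_lt_abs {R ϑ y : ℝ} (hR : 0 < R) (hϑ : 2 ≤ ϑ) (hy : R < |y|) :
    y ^ 2 ≤ R ^ (2 - ϑ) * |y| ^ ϑ := by
  have hy0 : 0 < |y| := hR.trans hy
  have h1 : |y| ^ (2 - ϑ) ≤ R ^ (2 - ϑ) := Real.rpow_le_rpow_of_nonpos hR hy.le (by linarith)
  calc y ^ 2 = |y| ^ (2 - ϑ) * |y| ^ ϑ := by
        rw [← Real.rpow_add hy0, sub_add_cancel, Real.rpow_two, sq_abs]
    _ ≤ _ := mul_le_mul_of_nonneg_right h1 (by positivity)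

theorem sq_trunc_sub_le {R ϑ : ℝ} (hR : 0 < R) (hϑ : 2 ≤ ϑ) (y : ℝ) :
    (trunc R y - y) ^ 2 ≤ R ^ (2 - ϑ) * |y| ^ ϑ := by
  rcases le_or_gt |y| R with h | h
  · rw [trunc_eq_self h, sub_self, zero_pow two_ne_zero]
    positivity
  · refine le_trans ?_ (sq_le_rpow_mul_of_lt_abs hR hϑ h)
    rw [sq_le_sq]
    exact abs_trunc_sub_le hR.le y

/-- If `|y| ≤ R`, then `|y| ≤ 2 * |x|`, so the moment of `x` pays; this is where `2 ^ ϑ` comes from.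
Otherwise the tail of `y` pays. -/
theorem sq_le_rpow_mul_of_le_abs {R ϑ x y : ℝ} (hR : 0 < R) (hϑ : 2 ≤ ϑ) (hx : R / 2 ≤ |x|) :
    y ^ 2 ≤ R ^ (2 - ϑ) * (2 ^ ϑ * |x| ^ ϑ + |y| ^ ϑ) := by
  rcases le_or_gt |y| R with h | h
  · have h1 : R ^ ϑ ≤ 2 ^ ϑ * |x| ^ ϑ := by
      rw [← Real.mul_rpow (by norm_num) (abs_nonneg x)]
      exact Real.rpow_le_rpow hR.le (by linarith) (by linarith)
    have h2 : 0 ≤ |y| ^ ϑ := by positivity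
    calc y ^ 2 = |y| ^ 2 := (sq_abs y).symm
      _ ≤ R ^ 2 := pow_le_pow_left₀ (abs_nonneg y) h 2
      _ = R ^ (2 - ϑ) * R ^ ϑ := by rw [← Real.rpow_add hR, sub_add_cancel, Real.rpow_two]
      _ ≤ _ := mul_le_mul_of_nonneg_left (by linarith) (by positivity)
  · refine (sq_le_rpow_mul_of_lt_abs hR hϑ h).trans
      (mul_le_mul_of_nonneg_left ?_ (by positivity))
    have : 0 ≤ (2 : ℝ) ^ ϑ * |x| ^ ϑ := by positivity
    linarith

/-- Jensen's inequality on `s`, obtained by expanding the nonnegative integral of the squared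
deviation from the mean. -/
theorem sq_setAverage_le {μ : Measure Ω} [IsFiniteMeasure μ] (s : Set Ω)
    {Z : Ω → ℝ} (hZ : MemLp Z 2 μ) :
    μ.real s * ((∫ ω in s, Z ω ∂μ) / μ.real s) ^ 2 ≤ ∫ ω in s, Z ω ^ 2 ∂μ := by
  rcases (measureReal_nonneg (μ := μ) (s := s)).eq_or_lt with h0 | h0
  · rw [← h0, zero_mul]
    exact integral_nonneg fun ω => sq_nonneg _
  · set d := (∫ ω in s, Z ω ∂μ) / μ.real s with hd
    have hZ1 : Integrable Z (μ.restrict s) := (hZ.integrable (by norm_num)).restrict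
    have hZ2 : Integrable (fun ω => Z ω ^ 2) (μ.restrict s) := hZ.integrable_sq.restrict
    have h1 : 0 ≤ ∫ ω in s, (Z ω - d) ^ 2 ∂μ := integral_nonneg fun ω => sq_nonneg _
    have h2 : ∫ ω in s, (Z ω - d) ^ 2 ∂μ =
        ∫ ω in s, Z ω ^ 2 ∂μ - 2 * d * ∫ ω in s, Z ω ∂μ + d ^ 2 * μ.real s := by
      have : ∀ ω, (Z ω - d) ^ 2 = Z ω ^ 2 - 2 * d * Z ω + d ^ 2 := fun ω => by ring
      simp_rw [this]
      have hZ3 : Integrable (fun ω => Z ω ^ 2 - 2 * d * Z ω) (μ.restrict s) :=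
        hZ2.sub (hZ1.const_mul _)
      rw [integral_add hZ3 (integrable_const _), integral_sub hZ2 (hZ1.const_mul _), integral_const_mul]
      simp [mul_comm]
    have h3 : ∫ ω in s, Z ω ∂μ = d * μ.real s := by
      rw [hd, div_mul_cancel₀ _ h0.ne']
    rw [h2, h3] at h1
    nlinarith

/-- The indicator of a set in `m` passes through the conditional expectation, which is a contraction
on `L²`. -/
theorem eLpNorm_indicator_condExp_le {μ : Measure Ω} [IsFiniteMeasure μ] {Y f : Ω → ℝ}
    {m : MeasurableSpace Ω} (hY : Integrable Y μ) (hf : f =ᵐ[μ] μ[Y | m]) {s : Set Ω}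
    (hs : MeasurableSet[m] s) :
    eLpNorm (s.indicator f) 2 μ ≤ eLpNorm (s.indicator Y) 2 μ := by
  have h1 : s.indicator f =ᵐ[μ] μ[s.indicator Y | m] := by
    refine EventuallyEq.trans ?_ (condExp_indicator hY hs).symm
    filter_upwards [hf] with ω hω
    by_cases h : ω ∈ s <;> simp [h, hω]
  rw [eLpNorm_congr_ae h1]
  exact eLpNorm_condExp_le_eLpNorm _ (by norm_num)

theorem rpow_half_sq {R : ℝ} (hR : 0 < R) (ϑ : ℝ) : (R ^ (-((ϑ - 2) / 2))) ^ 2 = R ^ (2 - ϑ) := by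
  rw [← Real.rpow_natCast, ← Real.rpow_mul hR.le]
  congr 1
  push_cast
  ring

/-- The average of the truncated response over a cell versus the regression function. -/
theorem abs_average_sub_le {μ : Measure Ω} [IsProbabilityMeasure μ] {X Y : Ω → ℝ}
    (hX : Measurable X) (hYm : Measurable Y) (hY : MemLp Y 2 μ) {f : ℝ → ℝ} {L : ℝ} (hL : 0 ≤ L)
    (hf : ∀ x y, |f x - f y| ≤ L * |x - y|)
    (hfX : (fun ω => f (X ω)) =ᵐ[μ] μ[Y | MeasurableSpace.comap X inferInstance])
    {R : ℝ} (hR : 0 ≤ R) {K ℓ : ℕ} {x : ℝ} (hx : x ∈ cell R K ℓ) (hp : 0 < μ.real (X ⁻¹' cell R K ℓ)) :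
    |(∫ ω, (cell R K ℓ).indicator (fun _ => (1 : ℝ)) (X ω) * trunc R (Y ω) ∂μ) /
        μ.real (X ⁻¹' cell R K ℓ) - f x| ≤
      (∫ ω in X ⁻¹' cell R K ℓ, |trunc R (Y ω) - Y ω| ∂μ) / μ.real (X ⁻¹' cell R K ℓ)
        + L * (R / K) := by
  set s := X ⁻¹' cell R K ℓ with hs
  have hsm : MeasurableSet s := hX (measurableSet_cell R K ℓ)
  have hY1 : Integrable Y μ := hY.integrable (by norm_num)
  have hfi : Integrable (fun ω => f (X ω)) μ := integrable_condExp.congr hfX.symm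
  have hti : Integrable (fun ω => trunc R (Y ω)) μ :=
    Integrable.of_bound ((measurable_trunc R).comp hYm).aestronglyMeasurable R
      (ae_of_all _ fun ω => abs_trunc_le hR _)
  have hq : ∫ ω, (cell R K ℓ).indicator (fun _ => (1 : ℝ)) (X ω) * trunc R (Y ω) ∂μ =
      ∫ ω in s, trunc R (Y ω) ∂μ := by
    rw [← integral_indicator hsm]
    congr 1 with ω
    by_cases h : X ω ∈ cell R K ℓ <;> simp [hs, h]
  have hYf : ∫ ω in s, f (X ω) ∂μ = ∫ ω in s, Y ω ∂μ := by
    rw [setIntegral_congr_ae hsm (hfX.mono fun ω h _ => h)]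
    exact setIntegral_condExp hX.comap_le hY1 ⟨_, measurableSet_cell R K ℓ, rfl⟩
  -- The cell is an event of the σ-algebra of `X`, so `Y` and `f (X ω)` have the same integral over
  -- it and may be exchanged. What remains is the truncation effect and the oscillation of `f` on a
  -- cell of width `R / K`.
  have hkey : (∫ ω in s, trunc R (Y ω) ∂μ) - f x * μ.real s =
      ∫ ω in s, (trunc R (Y ω) - Y ω) ∂μ + ∫ ω in s, (f (X ω) - f x) ∂μ := by
    rw [integral_sub hti.restrict hY1.restrict, integral_sub hfi.restrict (integrable_const _), hYf]
    simp
    ring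
  have h1 : |∫ ω in s, (trunc R (Y ω) - Y ω) ∂μ| ≤ ∫ ω in s, |trunc R (Y ω) - Y ω| ∂μ :=
    abs_integral_le_integral_abs
  have h2 : |∫ ω in s, (f (X ω) - f x) ∂μ| ≤ L * (R / K) * μ.real s := by
    refine norm_setIntegral_le_of_norm_le_const (f := fun ω => f (X ω) - f x)
      (measure_lt_top μ s) fun ω hω => ?_
    refine (hf _ _).trans (mul_le_mul_of_nonneg_left ?_ hL)
    have e : spaceGrid R K (ℓ + 1) = spaceGrid R K ℓ + R / K := by
      unfold spaceGrid
      push_cast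
      ring
    have h3 : X ω ∈ cell R K ℓ := hω
    unfold cell at h3 hx
    rw [e] at h3 hx
    rw [abs_le]
    constructor <;> linarith [h3.1, h3.2, hx.1, hx.2]
  rw [hq, div_add' _ _ _ hp.ne', div_sub' hp.ne', abs_div, abs_of_pos hp]
  refine div_le_div_of_nonneg_right ?_ hp.le
  rw [mul_comm (μ.real s), hkey]
  exact (abs_add_le _ _).trans (add_le_add h1 h2)

/-- The majorant is the cell average of the truncation effect. By Jensen on each cell its second
moment is at most that of `trunc R (Y ω) - Y ω`, irrespective of the number of cells. -/
theorem exists_truncation_majorant {μ : Measure Ω} [IsProbabilityMeasure μ] {ϑ b R : ℝ}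
    (hϑ : 2 ≤ ϑ) (hb : 0 ≤ b) (hR : 0 < R) {X Y : Ω → ℝ} (hXm : Measurable X) (hYm : Measurable Y)
    (hY : MemLp Y 2 μ) (hYi : Integrable (fun ω => |Y ω| ^ ϑ) μ) (hYb : ∫ ω, |Y ω| ^ ϑ ∂μ ≤ b)
    (K : ℕ) :
    ∃ H : Ω → ℝ, AEStronglyMeasurable H μ ∧ (∀ ω, 0 ≤ H ω) ∧
      eLpNorm H 2 μ ≤ ENNReal.ofReal (√b * R ^ (-((ϑ - 2) / 2))) ∧
      ∀ (ω) (ℓ : Fin K), X ω ∈ cell R K ℓ →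
        (∫ ω in X ⁻¹' cell R K ℓ, |trunc R (Y ω) - Y ω| ∂μ) / μ.real (X ⁻¹' cell R K ℓ) ≤ H ω := by
  set e : Fin K → ℝ → ℝ := fun ℓ => (cell R K ℓ).indicator fun _ => (1 : ℝ) with he
  have hem : ∀ ℓ, Measurable (e ℓ) := fun ℓ => measurable_indicator_cell R K ℓ
  have he0 : ∀ ℓ x, 0 ≤ e ℓ x := fun ℓ x => Set.indicator_nonneg (fun _ _ => zero_le_one) x
  have he1 : ∀ ℓ x, e ℓ x ≤ 1 := fun ℓ x => Set.indicator_le_self' (fun _ _ => zero_le_one) x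
  set Z : Ω → ℝ := fun ω => |trunc R (Y ω) - Y ω| with hZ
  have htm : Measurable fun ω => trunc R (Y ω) := (measurable_trunc R).comp hYm
  have hZL : MemLp Z 2 μ := by
    refine hY.of_le (htm.sub hYm).abs.aestronglyMeasurable (ae_of_all _ fun ω => ?_)
    simp only [hZ, Real.norm_eq_abs, abs_abs]
    exact abs_trunc_sub_le hR.le _
  have hZ2 : ∫ ω, Z ω ^ 2 ∂μ ≤ R ^ (2 - ϑ) * b := by
    refine (integral_mono hZL.integrable_sq (hYi.const_mul (R ^ (2 - ϑ))) fun ω => ?_).trans ?_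
    · simp only [hZ, sq_abs]
      exact sq_trunc_sub_le hR hϑ _
    · rw [integral_const_mul]
      exact mul_le_mul_of_nonneg_left hYb (by positivity)
  set p : Fin K → ℝ := fun ℓ => μ.real (X ⁻¹' cell R K ℓ) with hp
  set d : Fin K → ℝ := fun ℓ => (∫ ω in X ⁻¹' cell R K ℓ, Z ω ∂μ) / p ℓ with hd
  have hei : ∀ ℓ, Integrable (fun ω => e ℓ (X ω)) μ := fun ℓ =>
    Integrable.of_bound ((hem ℓ).comp hXm).aestronglyMeasurable 1 (ae_of_all _ fun ω => by
      rw [Real.norm_of_nonneg (he0 _ _)]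
      exact he1 _ _)
  have hepre : ∀ ℓ (g : Ω → ℝ), (fun ω => e ℓ (X ω) * g ω) = (X ⁻¹' cell R K ℓ).indicator g := by
    intro ℓ g
    ext ω
    by_cases h : X ω ∈ cell R K ℓ <;> simp [he, h]
  have hsm : ∀ ℓ : Fin K, MeasurableSet (X ⁻¹' cell R K ℓ) := fun ℓ => hXm (measurableSet_cell R K ℓ)
  have hint2 : ∀ ℓ, ∫ ω, e ℓ (X ω) * d ℓ ^ 2 ∂μ ≤ ∫ ω, e ℓ (X ω) * Z ω ^ 2 ∂μ := fun ℓ => by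
    rw [hepre, hepre, integral_indicator (hsm ℓ), integral_indicator (hsm ℓ)]
    refine le_trans (le_of_eq ?_) (sq_setAverage_le _ hZL)
    simp [hd, hp]
  have hF0 : ∀ ω, 0 ≤ ∑ ℓ, e ℓ (X ω) * d ℓ ^ 2 := fun ω =>
    Finset.sum_nonneg fun ℓ _ => mul_nonneg (he0 _ _) (sq_nonneg _)
  have heZi : ∀ ℓ, Integrable (fun ω => e ℓ (X ω) * Z ω ^ 2) μ := fun ℓ => by
    rw [hepre ℓ fun ω => Z ω ^ 2]
    exact hZL.integrable_sq.indicator (hsm ℓ)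
  refine ⟨fun ω => √(∑ ℓ, e ℓ (X ω) * d ℓ ^ 2), ?_, fun _ => Real.sqrt_nonneg _, ?_, ?_⟩
  · exact (Measurable.sqrt (Finset.measurable_sum _ fun ℓ _ =>
      ((hem ℓ).comp hXm).mul_const _)).aestronglyMeasurable
  · refine eLpNorm_sqrt_le hF0 (integrable_finsetSum _ fun ℓ _ => (hei ℓ).mul_const _)
      (by positivity) ?_
    rw [integral_finsetSum _ fun ℓ _ => (hei ℓ).mul_const _, mul_pow, Real.sq_sqrt hb,
      rpow_half_sq hR, mul_comm]
    refine (Finset.sum_le_sum fun ℓ _ => hint2 ℓ).trans (le_trans ?_ hZ2)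
    rw [← integral_finsetSum _ fun ℓ _ => heZi ℓ]
    refine integral_mono (integrable_finsetSum _ fun ℓ _ => heZi ℓ) hZL.integrable_sq fun ω => ?_
    dsimp only
    rw [← Finset.sum_mul]
    exact mul_le_of_le_one_left (sq_nonneg _) (sum_indicator_cell_le_one hR.le K _)
  · intro ω ℓ hℓ
    refine Real.le_sqrt_of_sq_le ?_
    refine le_trans (le_of_eq ?_) (Finset.single_le_sum (f := fun ℓ => e ℓ (X ω) * d ℓ ^ 2)
      (fun k _ => mul_nonneg (he0 _ _) (sq_nonneg _)) (Finset.mem_univ ℓ))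
    simp [he, hd, hp, hZ, hℓ]

/-- Being outside the grid is an event of the σ-algebra of `X`, so `f (X ω)` can be replaced there
by `Y`, to which the moment bounds with `|X ω| ≥ R / 2` apply. -/
theorem eLpNorm_indicator_outside_le {μ : Measure Ω} [IsProbabilityMeasure μ] {ϑ b R : ℝ}
    (hϑ : 2 ≤ ϑ) (hb : 0 ≤ b) (hR : 0 < R) {X Y : Ω → ℝ} (hXm : Measurable X)
    (hY : MemLp Y 2 μ) (hXi : Integrable (fun ω => |X ω| ^ ϑ) μ) (hXb : ∫ ω, |X ω| ^ ϑ ∂μ ≤ b)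
    (hYi : Integrable (fun ω => |Y ω| ^ ϑ) μ) (hYb : ∫ ω, |Y ω| ^ ϑ ∂μ ≤ b) {f : ℝ → ℝ}
    (hfX : (fun ω => f (X ω)) =ᵐ[μ] μ[Y | MeasurableSpace.comap X inferInstance]) :
    eLpNorm ((X ⁻¹' Ico (-(R / 2)) (R / 2))ᶜ.indicator fun ω => f (X ω)) 2 μ ≤
      ENNReal.ofReal (√((2 ^ ϑ + 1) * b) * R ^ (-((ϑ - 2) / 2))) := by
  have hYint : Integrable Y μ := hY.integrable (by norm_num)
  set s : Set Ω := (X ⁻¹' Ico (-(R / 2)) (R / 2))ᶜ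
  have hsX : MeasurableSet[MeasurableSpace.comap X inferInstance] s :=
    MeasurableSet.compl ⟨_, measurableSet_Ico, rfl⟩
  have hsm' : MeasurableSet s := hXm.comap_le _ hsX
  refine (eLpNorm_indicator_condExp_le hYint hfX hsX).trans ?_
  have hYs : MemLp (s.indicator Y) 2 μ := hY.indicator hsm'
  rw [← eLpNorm_norm]
  have : (fun ω => ‖s.indicator Y ω‖) = fun ω => √(s.indicator Y ω ^ 2) := by
    ext ω
    rw [Real.sqrt_sq_eq_abs, Real.norm_eq_abs]
  rw [this]
  have hbi : Integrable (fun ω => R ^ (2 - ϑ) * (2 ^ ϑ * |X ω| ^ ϑ + |Y ω| ^ ϑ)) μ :=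
    ((hXi.const_mul _).add hYi).const_mul _
  refine eLpNorm_sqrt_le (fun _ => sq_nonneg _) hYs.integrable_sq (by positivity) ?_
  refine (integral_mono hYs.integrable_sq hbi fun ω => ?_).trans ?_
  · dsimp only
    by_cases h : ω ∈ s
    · rw [Set.indicator_of_mem h]
      refine sq_le_rpow_mul_of_le_abs hR hϑ ?_
      by_contra hlt
      rw [not_le, abs_lt] at hlt
      exact h ⟨hlt.1.le, hlt.2⟩
    · rw [Set.indicator_of_notMem h, zero_pow two_ne_zero]
      positivity
  · rw [integral_const_mul, integral_add (hXi.const_mul _) hYi, integral_const_mul, mul_pow,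
      Real.sq_sqrt (by positivity), rpow_half_sq hR, mul_comm ((2 ^ ϑ + 1) * b)]
    refine mul_le_mul_of_nonneg_left ?_ (by positivity)
    have : (2 : ℝ) ^ ϑ * ∫ ω, |X ω| ^ ϑ ∂μ ≤ 2 ^ ϑ * b :=
      mul_le_mul_of_nonneg_left hXb (by positivity)
    linarith

/-- The mean square distance of the truncated least-squares estimate to a Lipschitz regression
function, with a measurable majorant (the estimate itself need not be measurable). -/
theorem exists_regression_majorant {μ : Measure Ω} [IsProbabilityMeasure μ]
    {P : Option ℕ → Ω → ℝ × ℝ} (hm : ∀ k, Measurable (P k)) (hi : iIndepFun P μ)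
    (hid : ∀ m, IdentDistrib (P (some m)) (P none) μ μ) {ϑ b L R : ℝ} (hϑ : 2 ≤ ϑ) (hb : 0 ≤ b)
    (hL : 0 ≤ L) (hR : 0 < R) {X Y : Ω → ℝ} (hXY : P none = fun ω => (X ω, Y ω))
    (hY : MemLp Y 2 μ) (hXi : Integrable (fun ω => |X ω| ^ ϑ) μ) (hXb : ∫ ω, |X ω| ^ ϑ ∂μ ≤ b)
    (hYi : Integrable (fun ω => |Y ω| ^ ϑ) μ) (hYb : ∫ ω, |Y ω| ^ ϑ ∂μ ≤ b)
    {f : ℝ → ℝ} (hf : ∀ x y, |f x - f y| ≤ L * |x - y|)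
    (hfX : (fun ω => f (X ω)) =ᵐ[μ] μ[Y | MeasurableSpace.comap X inferInstance])
    {K M : ℕ} (hK : 0 < K) (hM : 0 < M) {ψ : Ω → ℝ → ℝ}
    (hψ : ∀ ω, IsLeastSquares (piecewiseConstant R K) M R (fun m => (P (some m) ω).1)
      (fun m => (P (some m) ω).2) (ψ ω)) :
    ∃ H : Ω → ℝ, AEStronglyMeasurable H μ ∧ (∀ ω, 0 ≤ H ω) ∧
      eLpNorm H 2 μ ≤ ENNReal.ofReal (2 * R * √(K / M) + L * (R / K) +
        (√b + √((2 ^ ϑ + 1) * b)) * R ^ (-((ϑ - 2) / 2))) ∧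
      ∀ᵐ ω ∂μ, |trunc R (ψ ω (X ω)) - f (X ω)| ≤ H ω := by
  have hX1 : ∀ ω, (P none ω).1 = X ω := fun ω => by rw [hXY]
  have hY1 : ∀ ω, (P none ω).2 = Y ω := fun ω => by rw [hXY]
  have hXm : Measurable X := by simpa only [hX1] using (hm none).fst
  have hYm : Measurable Y := by simpa only [hY1] using (hm none).snd
  obtain ⟨H₁, h1m, h10, h1n, h1b⟩ := exists_statistical_majorant hm hi hid hR.le hM hψ
  simp only [hX1, hY1] at h1b
  obtain ⟨H₂, h2m, h20, h2n, h2b⟩ := exists_truncation_majorant hϑ hb hR hXm hYm hY hYi hYb K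
  have h4n := eLpNorm_indicator_outside_le hϑ hb hR hXm hY hXi hXb hYi hYb hfX
  set s : Set Ω := (X ⁻¹' Ico (-(R / 2)) (R / 2))ᶜ with hs
  have hsm' : MeasurableSet s := (hXm measurableSet_Ico).compl
  have hfi : Integrable (fun ω => f (X ω)) μ := integrable_condExp.congr hfX.symm
  have h4m : AEStronglyMeasurable (fun ω => |s.indicator (fun ω => f (X ω)) ω|) μ :=
    (hfi.indicator hsm').abs.aestronglyMeasurable
  have hLRK : 0 ≤ L * (R / K) := by positivity
  -- The summands are the statistical error, the oscillation of `f` on a cell, the truncation bias,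
  -- and the regression function outside the grid.
  refine ⟨fun ω => H₁ ω + L * (R / K) + H₂ ω +
    |s.indicator (fun ω => f (X ω)) ω|, ((h1m.add aestronglyMeasurable_const).add h2m).add h4m,
    fun ω => ?_, ?_, ?_⟩
  · have := h10 ω
    have := h20 ω
    positivity
  · have h4n' := (eLpNorm_abs μ (s.indicator fun ω => f (X ω)) 2).trans_le h4n
    have hLm : AEStronglyMeasurable (fun _ : Ω => L * (R / K)) μ := aestronglyMeasurable_const
    have hR' : 0 < R ^ (-((ϑ - 2) / 2)) := Real.rpow_pos_of_pos hR _
    have e1 := eLpNorm_add_le_ofReal h1m hLm (by positivity) hLRK h1n (eLpNorm_const_le_ofReal hLRK)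
    have e2 := eLpNorm_add_le_ofReal (h1m.add hLm) h2m (by positivity) (by positivity) e1 h2n
    have e3 := eLpNorm_add_le_ofReal ((h1m.add hLm).add h2m) h4m (by positivity) (by positivity)
      e2 h4n'
    rw [add_mul, ← add_assoc]
    exact e3
  · have hpos : ∀ᵐ ω ∂μ, ∀ ℓ : Fin K, X ω ∈ cell R K ℓ → 0 < μ.real (X ⁻¹' cell R K ℓ) := by
      rw [ae_all_iff]
      intro ℓ
      rcases (measureReal_nonneg (μ := μ) (s := X ⁻¹' cell R K ℓ)).eq_or_lt with h0 | h0
      · have : μ (X ⁻¹' cell R K ℓ) = 0 := by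
          rwa [eq_comm, measureReal_eq_zero_iff] at h0
        filter_upwards [measure_eq_zero_iff_ae_notMem.1 this] with ω hω h
        exact absurd h hω
      · exact ae_of_all _ fun _ _ => h0
    filter_upwards [hpos] with ω hω
    have n1 := h10 ω
    have n2 := h20 ω
    by_cases hc : ∃ ℓ : Fin K, X ω ∈ cell R K ℓ
    · obtain ⟨ℓ, hℓ⟩ := hc
      have a1 := h1b ω ℓ hℓ (hω ℓ hℓ)
      have a2 := abs_average_sub_le hXm hYm hY hL hf hfX hR.le hℓ (hω ℓ hℓ)
      have a3 := h2b ω ℓ hℓ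
      have a4 := abs_sub_le (trunc R (ψ ω (X ω)))
        ((∫ ω, (cell R K ℓ).indicator (fun _ => (1 : ℝ)) (X ω) * trunc R (Y ω) ∂μ) /
          μ.real (X ⁻¹' cell R K ℓ)) (f (X ω))
      have a5 := abs_nonneg (s.indicator (fun ω => f (X ω)) ω)
      linarith
    · have hω' : ω ∈ s := fun h => hc (exists_mem_cell hK h.1 h.2)
      push Not at hc
      rw [eq_zero_of_notMem_cell (hψ ω).1 hc, trunc_eq_self (by simpa using hR.le), zero_sub, abs_neg,
        Set.indicator_of_mem hω']
      linarith

end LSMC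

namespace LSMC

variable {Ω : Type*} [mΩ : MeasurableSpace Ω]

/-! ### Time integrals and conditional expectations -/

theorem lintegral_rpow_two_eq (μ : Measure Ω) (f : Ω → ℝ) :
    ∫⁻ ω, ‖f ω‖ₑ ^ (2 : ℝ) ∂μ = eLpNorm f 2 μ ^ (2 : ℝ) := by
  rw [eLpNorm_eq_lintegral_rpow_enorm_toReal (by simp) (by simp), ← ENNReal.rpow_mul]
  simp

theorem eLpNorm_two_le_of_lintegral_le {μ : Measure Ω} {f : Ω → ℝ} {C : ℝ≥0∞}
    (h : ∫⁻ ω, ‖f ω‖ₑ ^ (2 : ℝ) ∂μ ≤ C ^ (2 : ℝ)) : eLpNorm f 2 μ ≤ C := by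
  rw [lintegral_rpow_two_eq] at h
  exact (ENNReal.rpow_le_rpow_iff (by norm_num)).1 h

section TimeIntegral

variable {μ : Measure Ω} [IsProbabilityMeasure μ] {T c : ℝ} {h : Ω × ℝ → ℝ}

theorem lintegral_lintegral_sq_le (hm : Measurable h)
    (hb : ∀ᵐ r ∂(volume.restrict (Ioc 0 T)), eLpNorm (fun ω => h (ω, r)) 2 μ ≤ ENNReal.ofReal c) :
    ∫⁻ ω, (∫⁻ r in Ioc 0 T, ‖h (ω, r)‖ₑ ^ (2 : ℝ)) ∂μ ≤
      ENNReal.ofReal T * ENNReal.ofReal c ^ (2 : ℝ) := by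
  rw [lintegral_lintegral_swap (f := fun ω r => ‖h (ω, r)‖ₑ ^ (2 : ℝ))
    (hm.enorm.pow_const _).aemeasurable]
  calc ∫⁻ r in Ioc 0 T, (∫⁻ ω, ‖h (ω, r)‖ₑ ^ (2 : ℝ) ∂μ)
      ≤ ∫⁻ r in Ioc 0 T, ENNReal.ofReal c ^ (2 : ℝ) := by
        refine lintegral_mono_ae (hb.mono fun r hr => ?_)
        rw [lintegral_rpow_two_eq μ fun ω => h (ω, r)]
        exact ENNReal.rpow_le_rpow hr (by norm_num)
    _ = _ := by
        rw [lintegral_const]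
        simp [mul_comm]

theorem integrable_prod_of_eLpNorm_le (hm : Measurable h)
    (hb : ∀ᵐ r ∂(volume.restrict (Ioc 0 T)), eLpNorm (fun ω => h (ω, r)) 2 μ ≤ ENNReal.ofReal c) :
    Integrable h (μ.prod (volume.restrict (Ioc 0 T))) := by
  refine MemLp.integrable (q := 2) (by norm_num) ⟨hm.aestronglyMeasurable, ?_⟩
  refine lt_of_le_of_lt (b := (ENNReal.ofReal T * ENNReal.ofReal c ^ (2 : ℝ)) ^ (1 / 2 : ℝ)) ?_
    (ENNReal.rpow_lt_top_of_nonneg (by norm_num)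
      (ENNReal.mul_ne_top (by simp) (ENNReal.rpow_ne_top_of_nonneg (by norm_num) (by simp))))
  refine eLpNorm_two_le_of_lintegral_le ?_
  rw [lintegral_prod _ (hm.enorm.pow_const _).aemeasurable, ← ENNReal.rpow_mul]
  refine (lintegral_lintegral_sq_le hm hb).trans_eq ?_
  norm_num

/-- Cauchy–Schwarz in time and then Tonelli; each contributes a factor `√T`. -/
theorem eLpNorm_integral_abs_le (hT : 0 ≤ T) (hm : Measurable h)
    (hb : ∀ᵐ r ∂(volume.restrict (Ioc 0 T)), eLpNorm (fun ω => h (ω, r)) 2 μ ≤ ENNReal.ofReal c) :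
    eLpNorm (fun ω => ∫ r in Ioc 0 T, |h (ω, r)|) 2 μ ≤ ENNReal.ofReal (T * c) := by
  refine eLpNorm_two_le_of_lintegral_le ?_
  have hvol : (volume.restrict (Ioc 0 T)) univ = ENNReal.ofReal T := by simp
  have h1 : ∀ ω, ‖∫ r in Ioc 0 T, |h (ω, r)|‖ₑ ^ (2 : ℝ) ≤
      ENNReal.ofReal T * ∫⁻ r in Ioc 0 T, ‖h (ω, r)‖ₑ ^ (2 : ℝ) := fun ω => by
    have e1 : ‖∫ r in Ioc 0 T, |h (ω, r)|‖ₑ ≤ eLpNorm (fun r => h (ω, r)) 1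
        (volume.restrict (Ioc 0 T)) := by
      refine (enorm_integral_le_lintegral_enorm _).trans_eq ?_
      rw [eLpNorm_one_eq_lintegral_enorm]
      simp
    have hmω : Measurable fun r => h (ω, r) := hm.comp (measurable_const.prodMk measurable_id)
    have e2 := eLpNorm_le_eLpNorm_mul_rpow_measure_univ (μ := volume.restrict (Ioc 0 T))
      (p := 1) (q := 2) (by norm_num) hmω.aestronglyMeasurable
    refine (ENNReal.rpow_le_rpow (e1.trans e2) (by norm_num)).trans_eq ?_
    rw [ENNReal.mul_rpow_of_nonneg _ _ (by norm_num), ← lintegral_rpow_two_eq, hvol,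
      ← ENNReal.rpow_mul, mul_comm]
    norm_num
  have hin : Measurable fun ω => ∫⁻ r in Ioc 0 T, ‖h (ω, r)‖ₑ ^ (2 : ℝ) :=
    (hm.enorm.pow_const _).lintegral_prod_right'
  refine (lintegral_mono h1).trans ?_
  rw [lintegral_const_mul _ hin]
  refine (mul_le_mul_right (lintegral_lintegral_sq_le hm hb) _).trans_eq ?_
  rw [ENNReal.ofReal_mul hT, ENNReal.mul_rpow_of_nonneg _ _ (by norm_num), ← mul_assoc,
    ENNReal.rpow_two (ENNReal.ofReal T), sq]

end TimeIntegral

/-- Conditioning on the product space with respect to `m` times the Borel sets yields versions of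
the conditional expectations of all `G (·, u)` that are jointly measurable in the sample point and
`u`. Only the integrals over rectangles are used later. -/
theorem exists_prod_condExp {Ω : Type*} {m : MeasurableSpace Ω} [mΩ : MeasurableSpace Ω]
    {μ : Measure Ω} [IsFiniteMeasure μ] (hm : m ≤ mΩ) (ν : Measure ℝ) [IsFiniteMeasure ν]
    {G : Ω × ℝ → ℝ} (hG : Integrable G (μ.prod ν)) :
    ∃ Z : Ω × ℝ → ℝ, StronglyMeasurable[@Prod.instMeasurableSpace Ω ℝ m _] Z ∧
      Integrable Z (μ.prod ν) ∧ ∀ F : Set Ω, MeasurableSet[m] F → ∀ t : Set ℝ, MeasurableSet t →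
        ∫ z in F ×ˢ t, Z z ∂(μ.prod ν) = ∫ z in F ×ˢ t, G z ∂(μ.prod ν) := by
  have hle : @Prod.instMeasurableSpace Ω ℝ m _ ≤ @Prod.instMeasurableSpace Ω ℝ mΩ _ :=
    sup_le_sup (MeasurableSpace.comap_mono hm) le_rfl
  refine ⟨(μ.prod ν)[G | @Prod.instMeasurableSpace Ω ℝ m _], stronglyMeasurable_condExp,
    integrable_condExp, fun F hF t ht => setIntegral_condExp hle hG ?_⟩
  exact @MeasurableSet.prod Ω ℝ m _ _ _ hF ht

/-- Conditional expectations of time integrals have a version that is continuous in time. -/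
theorem exists_continuous_condExp_integral {Ω : Type*} {m : MeasurableSpace Ω}
    [mΩ : MeasurableSpace Ω] {μ : Measure Ω} [IsFiniteMeasure μ]
    (hm : m ≤ mΩ) {T : ℝ} {G : Ω × ℝ → ℝ}
    (hG : Integrable G (μ.prod (volume.restrict (Ioc 0 T)))) :
    ∃ Y : ℝ → Ω → ℝ,
      (∀ s ∈ Icc 0 T, Y s =ᵐ[μ] μ[fun ω => ∫ u in (0 : ℝ)..s, G (ω, u) | m]) ∧
      ∀ᵐ ω ∂μ, Continuous fun s => Y s ω := by
  set ν : Measure ℝ := volume.restrict (Ioc 0 T) with hν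
  obtain ⟨Z, hZm, hZi, hZG⟩ := exists_prod_condExp hm ν hG
  have hY0 : ∀ s ∈ Icc 0 T, ∀ (F : ℝ → ℝ), ∫ u in (0 : ℝ)..s, F u ∂ν = ∫ u in Ioc 0 s, F u ∂ν :=
    fun s hs F => intervalIntegral.integral_of_le hs.1
  have hYv : ∀ s ∈ Icc 0 T, ∀ (F : ℝ → ℝ), ∫ u in Ioc 0 s, F u ∂ν = ∫ u in (0 : ℝ)..s, F u :=
    fun s hs F => by
      rw [intervalIntegral.integral_of_le hs.1, hν, Measure.restrict_restrict measurableSet_Ioc,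
        inter_eq_left.2 (Ioc_subset_Ioc_right hs.2)]
  -- Integrating against `ν` makes the primitive of `Z (ω, ·)` continuous on the whole line,
  -- although integrability is known only on `(0, T]`.
  refine ⟨fun s ω => ∫ u in (0 : ℝ)..s, Z (ω, u) ∂ν, fun s hs => ?_, ?_⟩
  · have hGs : Integrable (fun ω => ∫ u in (0 : ℝ)..s, G (ω, u)) μ := by
      simp_rw [← hYv s hs]
      have : Integrable G (μ.prod (ν.restrict (Ioc 0 s))) := by
        refine hG.mono_measure ?_
        exact Measure.prod_mono le_rfl Measure.restrict_le_self
      exact this.integral_prod_left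
    have hZs : Integrable (fun ω => ∫ u in (0 : ℝ)..s, Z (ω, u) ∂ν) μ := by
      simp_rw [hY0 s hs]
      have : Integrable Z (μ.prod (ν.restrict (Ioc 0 s))) := by
        refine hZi.mono_measure ?_
        exact Measure.prod_mono le_rfl Measure.restrict_le_self
      exact this.integral_prod_left
    refine ae_eq_condExp_of_forall_setIntegral_eq hm hGs (fun _ _ _ => hZs.integrableOn)
      (fun F hF _ => ?_) ?_
    · simp_rw [← hYv s hs, hY0 s hs]
      rw [← setIntegral_prod Z hZi.integrableOn, ← setIntegral_prod G hG.integrableOn]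
      exact hZG F hF _ measurableSet_Ioc
    · simp_rw [hY0 s hs]
      exact (@StronglyMeasurable.integral_prod_right' Ω ℝ ℝ m _ (ν.restrict (Ioc 0 s)) _ _ _ Z
        hZm).aestronglyMeasurable
  · filter_upwards [hZi.prod_right_ae] with ω hω
    exact intervalIntegral.continuous_primitive (fun a b => hω.intervalIntegrable) 0

/-- The Markov property for indicators extends to integrable random variables. -/
theorem condExp_eq_of_forall_indicator {Ω : Type*} {m₁ m₂ : MeasurableSpace Ω}
    [mΩ : MeasurableSpace Ω] {μ : Measure Ω} [IsFiniteMeasure μ] {X : Ω → ℝ} (hX : Measurable X) (hXi : Integrable X μ)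
    (h : ∀ B : Set ℝ, MeasurableSet B →
      μ[(X ⁻¹' B).indicator (fun _ => (1 : ℝ)) | m₁] =ᵐ[μ]
        μ[(X ⁻¹' B).indicator (fun _ => (1 : ℝ)) | m₂]) :
    μ[X | m₁] =ᵐ[μ] μ[X | m₂] := by
  have hs : ∀ g : SimpleFunc ℝ ℝ, μ[fun ω => g (X ω) | m₁] =ᵐ[μ] μ[fun ω => g (X ω) | m₂] := by
    intro g
    induction g using SimpleFunc.induction with
    | const c hs =>
      rename_i s
      have e : (fun ω => (SimpleFunc.piecewise s hs (SimpleFunc.const ℝ c) (SimpleFunc.const ℝ 0))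
          (X ω)) = c • (X ⁻¹' s).indicator (fun _ => (1 : ℝ)) := by
        ext ω
        by_cases h : X ω ∈ s <;> simp [h]
      rw [e]
      filter_upwards [condExp_smul c ((X ⁻¹' s).indicator (fun _ => (1 : ℝ))) m₁ (μ := μ),
        condExp_smul c ((X ⁻¹' s).indicator (fun _ => (1 : ℝ))) m₂ (μ := μ), h s hs] with ω h1 h2 h3
      rw [h1, h2, Pi.smul_apply, Pi.smul_apply, h3]
    | add _ hf hg =>
      rename_i f g _
      have hi : ∀ f : SimpleFunc ℝ ℝ, Integrable (fun ω => f (X ω)) μ := fun f =>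
        (f.integrable_of_isFiniteMeasure (μ := μ.map X)).comp_measurable hX
      have e : (fun ω => (f + g) (X ω)) = (fun ω => f (X ω)) + fun ω => g (X ω) := rfl
      rw [e]
      filter_upwards [condExp_add (hi f) (hi g) m₁, condExp_add (hi f) (hi g) m₂, hf, hg]
        with ω h1 h2 h3 h4
      rw [h1, h2, Pi.add_apply, Pi.add_apply, h3, h4]
  have hid : MemLp (id : ℝ → ℝ) 1 (μ.map X) := by
    rw [memLp_one_iff_integrable, integrable_map_measure aestronglyMeasurable_id hX.aemeasurable]
    exact hXi
  -- Approximate `X` in `L¹` by simple functions of `X`. Their two conditional expectations agree,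
  -- and each remainder contributes at most `ε / 2` by contraction.
  have hzero : eLpNorm (μ[X | m₁] - μ[X | m₂]) 1 μ = 0 := by
    refine le_antisymm (ENNReal.le_of_forall_pos_le_add fun ε hε _ => ?_) zero_le
    obtain ⟨g, hg, hgL⟩ := hid.exists_simpleFunc_eLpNorm_sub_lt (ε := (ε : ℝ≥0∞) / 2) (by simp)
      (by simpa using hε.ne')
    have hgi : Integrable (fun ω => g (X ω)) μ :=
      (memLp_one_iff_integrable.1 hgL).comp_measurable hX
    have hd : eLpNorm (X - fun ω => g (X ω)) 1 μ ≤ (ε : ℝ≥0∞) / 2 := by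
      rw [eLpNorm_map_measure (aestronglyMeasurable_id.sub g.measurable.aestronglyMeasurable)
        hX.aemeasurable] at hg
      exact hg.le
    have e : μ[X | m₁] - μ[X | m₂] =ᵐ[μ]
        μ[X - (fun ω => g (X ω)) | m₁] - μ[X - (fun ω => g (X ω)) | m₂] := by
      filter_upwards [condExp_sub hXi hgi m₁, condExp_sub hXi hgi m₂, hs g] with ω h1 h2 h3
      simp only [Pi.sub_apply] at h1 h2 ⊢
      rw [h1, h2, h3]
      ring
    rw [eLpNorm_congr_ae e, zero_add, ← ENNReal.add_halves (ε : ℝ≥0∞)]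
    refine (eLpNorm_sub_le integrable_condExp.aestronglyMeasurable
      integrable_condExp.aestronglyMeasurable le_rfl).trans (add_le_add ?_ ?_)
    · exact (eLpNorm_condExp_le_eLpNorm _ le_rfl).trans hd
    · exact (eLpNorm_condExp_le_eLpNorm _ le_rfl).trans hd
  rw [eLpNorm_eq_zero_iff (integrable_condExp.sub integrable_condExp).aestronglyMeasurable
    one_ne_zero] at hzero
  filter_upwards [hzero] with ω hω
  simpa [sub_eq_zero] using hω

/-- The exceptional null sets are collected over a countable dense subset of `S`; continuity extends
the inequality to all of `S`. -/
theorem ae_forall_le_of_continuousOn {μ : Measure Ω} {S : Set ℝ} {f : ℝ → Ω → ℝ} {g : Ω → ℝ}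
    (h : ∀ s ∈ S, ∀ᵐ ω ∂μ, f s ω ≤ g ω)
    (hc : ∀ᵐ ω ∂μ, ContinuousOn (fun s => f s ω) S) : ∀ᵐ ω ∂μ, ∀ s ∈ S, f s ω ≤ g ω := by
  obtain ⟨D, hDc, hDd⟩ := TopologicalSpace.exists_countable_dense S
  have h1 : ∀ᵐ ω ∂μ, ∀ s ∈ D, f s ω ≤ g ω :=
    (ae_ball_iff hDc).2 fun s _ => h s s.2
  filter_upwards [h1, hc] with ω h2 h3 s hs
  have hcl : IsClosed {x : S | f x ω ≤ g ω} :=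
    isClosed_le (continuousOn_iff_continuous_domRestrict.1 h3) continuous_const
  have : closure D ⊆ {x : S | f x ω ≤ g ω} := closure_minimal (fun x hx => h2 x hx) hcl
  exact this (hDd ⟨s, hs⟩)

end LSMC

namespace LSMC

/-! ### The time grid -/

theorem timeGrid_zero (T : ℝ) (N : ℕ) : timeGrid T N 0 = 0 := by simp [timeGrid]

theorem timeGrid_self (T : ℝ) {N : ℕ} (hN : 0 < N) : timeGrid T N N = T := by
  have : (N : ℝ) ≠ 0 := by positivity
  unfold timeGrid
  field_simp

theorem timeGrid_succ (T : ℝ) (N i : ℕ) : timeGrid T N (i + 1) = timeGrid T N i + T / N := by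
  unfold timeGrid
  push_cast
  ring

theorem monotone_timeGrid {T : ℝ} (hT : 0 ≤ T) (N : ℕ) : Monotone (timeGrid T N) := by
  intro a b hab
  unfold timeGrid
  gcongr

theorem timeGrid_mem_Icc {T : ℝ} (hT : 0 ≤ T) {N i : ℕ} (hN : 0 < N) (hi : i ≤ N) :
    timeGrid T N i ∈ Icc 0 T :=
  ⟨(timeGrid_zero T N).symm.trans_le (monotone_timeGrid hT N i.zero_le),
    (monotone_timeGrid hT N hi).trans_eq (timeGrid_self T hN)⟩

theorem exists_mem_timeGrid {T : ℝ} (hT : 0 < T) {N : ℕ} (hN : 0 < N) {t : ℝ} (h0 : 0 ≤ t)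
    (ht : t < T) : ∃ i < N, t ∈ Ico (timeGrid T N i) (timeGrid T N (i + 1)) := by
  have hN' : (0 : ℝ) < N := by exact_mod_cast hN
  have hy : 0 ≤ t * N / T := by positivity
  have hyN : t * N / T < N := by
    rw [div_lt_iff₀ hT, mul_comm]
    gcongr
  refine ⟨⌊t * N / T⌋₊, (Nat.floor_lt hy).2 hyN, ?_, ?_⟩
  · have := Nat.floor_le hy
    rw [le_div_iff₀ hT] at this
    unfold timeGrid
    rwa [div_le_iff₀ hN']
  · have := Nat.lt_floor_add_one (t * N / T)
    rw [div_lt_iff₀ hT] at this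
    unfold timeGrid
    rw [lt_div_iff₀ hN']
    exact_mod_cast this

theorem sum_indicator_timeGrid {T : ℝ} (hT : 0 ≤ T) {N i : ℕ} (hi : i < N) {r : ℝ}
    (hr : r ∈ Ico (timeGrid T N i) (timeGrid T N (i + 1))) (a : ℕ → ℝ) :
    ∑ j ∈ Finset.range N,
      (Ico (timeGrid T N j) (timeGrid T N (j + 1))).indicator (fun _ => a j) r = a i := by
  rw [Finset.sum_eq_single_of_mem i (Finset.mem_range.2 hi)]
  · simp [hr]
  · intro j _ hj
    have hd := (monotone_timeGrid hT N).pairwise_disjoint_on_Ico_succ hj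
    exact Set.indicator_of_notMem (fun h => Set.disjoint_left.1 hd h hr) _

/-- The time spent by `[t,s]` in the `j`-th interval of the time grid. -/
noncomputable def gridWeight (T : ℝ) (N : ℕ) (t s : ℝ) (j : ℕ) : ℝ :=
  ∫ r in t..s, (Ico (timeGrid T N j) (timeGrid T N (j + 1))).indicator (fun _ => (1 : ℝ)) r

theorem integrable_indicator_Ico (a b c : ℝ) :
    Integrable ((Ico a b).indicator fun _ => c) :=
  (integrable_indicator_iff measurableSet_Ico).2 (by simp)

theorem gridWeight_nonneg (T : ℝ) (N : ℕ) {t s : ℝ} (hts : t ≤ s) (j : ℕ) :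
    0 ≤ gridWeight T N t s j :=
  intervalIntegral.integral_nonneg hts fun _ _ => Set.indicator_nonneg (fun _ _ => zero_le_one) _

theorem gridWeight_le {T : ℝ} (hT : 0 ≤ T) (N : ℕ) {t s : ℝ} (hts : t ≤ s) (j : ℕ) :
    gridWeight T N t s j ≤ T / N := by
  unfold gridWeight
  rw [intervalIntegral.integral_of_le hts]
  refine (setIntegral_le_integral (integrable_indicator_Ico _ _ _)
    (ae_of_all _ fun _ => Set.indicator_nonneg (fun _ _ => zero_le_one) _)).trans_eq ?_
  have h0 : 0 ≤ T / N := by positivity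
  rw [integral_indicator measurableSet_Ico]
  simp [timeGrid_succ, h0]

theorem gridWeight_eq_zero {T : ℝ} (N : ℕ) {t s : ℝ} (hts : t ≤ s) {j : ℕ}
    (h : timeGrid T N (j + 1) ≤ t ∨ s ≤ timeGrid T N j) : gridWeight T N t s j = 0 := by
  unfold gridWeight
  rw [intervalIntegral.integral_of_le hts, ← integral_Ico_eq_integral_Ioc]
  refine setIntegral_eq_zero_of_forall_eq_zero fun r hr => Set.indicator_of_notMem (fun h' => ?_) _
  rcases h with h | h
  · exact absurd h'.2 (not_lt.2 (h.trans hr.1))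
  · exact absurd h'.1 (not_le.2 (hr.2.trans_le h))

theorem continuous_gridWeight (T : ℝ) (N : ℕ) (t : ℝ) (j : ℕ) :
    Continuous fun s => gridWeight T N t s j :=
  intervalIntegral.continuous_primitive
    (fun _ _ => (integrable_indicator_Ico _ _ _).intervalIntegrable) t

theorem integral_sum_indicator_timeGrid (T : ℝ) (N : ℕ) (t s : ℝ) (a : ℕ → ℝ) :
    ∫ r in t..s, ∑ j ∈ Finset.range N,
      (Ico (timeGrid T N j) (timeGrid T N (j + 1))).indicator (fun _ => a j) r =
      ∑ j ∈ Finset.range N, gridWeight T N t s j * a j := by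
  rw [intervalIntegral.integral_finsetSum fun j _ =>
    (integrable_indicator_Ico _ _ _).intervalIntegrable]
  refine Finset.sum_congr rfl fun j _ => ?_
  unfold gridWeight
  rw [← intervalIntegral.integral_mul_const]
  congr 1 with r
  by_cases h : r ∈ Ico (timeGrid T N j) (timeGrid T N (j + 1)) <;> simp [h]

/-- Since `t` lies in exactly one grid interval, the sum over the first index collapses, and the
time integral only weighs the second. -/
theorem integral_regressionProcess {Ω : Type*} {T : ℝ} (hT : 0 ≤ T) {N i : ℕ} (hi : i < N) (R : ℝ)
    (I : ℝ → Ω → ℝ) (ψ : ℕ → ℕ → Ω → ℝ → ℝ) {t : ℝ}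
    (ht : t ∈ Ico (timeGrid T N i) (timeGrid T N (i + 1))) (s : ℝ) (ω : Ω) :
    ∫ r in t..s, regressionProcess T N R I ψ t r ω =
      ∑ j ∈ Finset.range N,
        gridWeight T N t s j * trunc R (ψ i j ω (I (timeGrid T N i) ω)) := by
  rw [← integral_sum_indicator_timeGrid]
  congr 1 with r
  unfold regressionProcess
  rw [Finset.sum_comm]
  refine Finset.sum_congr rfl fun j _ => ?_
  by_cases hr : r ∈ Ico (timeGrid T N j) (timeGrid T N (j + 1))
  · rw [Set.indicator_of_mem hr, ← sum_indicator_timeGrid hT hi ht fun i =>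
      trunc R (ψ i j ω (I (timeGrid T N i) ω))]
    refine Finset.sum_congr rfl fun k _ => ?_
    by_cases hk : t ∈ Ico (timeGrid T N k) (timeGrid T N (k + 1))
    · rw [Set.indicator_of_mem hk, Set.indicator_of_mem (mk_mem_prod hk hr)]
    · rw [Set.indicator_of_notMem hk, Set.indicator_of_notMem fun h => hk h.1]
  · rw [Set.indicator_of_notMem hr]
    exact Finset.sum_eq_zero fun k _ => Set.indicator_of_notMem (fun h => hr h.2) _

/-! ### Time discretisation of a regular signal -/

/-- The process with its time clamped to `[0,T]`, as a function on `Ω × ℝ`. -/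
def clampPath {Ω : Type*} (T : ℝ) (I : ℝ → Ω → ℝ) : Ω × ℝ → ℝ := fun p => I (max 0 (min p.2 T)) p.1

theorem clampPath_of_mem {Ω : Type*} {T : ℝ} (I : ℝ → Ω → ℝ) {r : ℝ} (hr : r ∈ Icc 0 T) (ω : Ω) :
    clampPath T I (ω, r) = I r ω := by
  simp [clampPath, hr.1, hr.2]

/-- The process frozen at the left end of each interval of the time grid. -/
noncomputable def stepPath {Ω : Type*} (T : ℝ) (N : ℕ) (I : ℝ → Ω → ℝ) : Ω × ℝ → ℝ := fun p =>
  ∑ j ∈ Finset.range N, (Ico (timeGrid T N j) (timeGrid T N (j + 1))).indicator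
    (fun _ => I (timeGrid T N j) p.1) p.2

/-- The `L¹([0,T])`-distance of the paths to the frozen paths. -/
noncomputable def stepError {Ω : Type*} (T : ℝ) (N : ℕ) (I : ℝ → Ω → ℝ) (ω : Ω) : ℝ :=
  ∫ r in Ioc 0 T, |clampPath T I (ω, r) - stepPath T N I (ω, r)|

namespace IsRegularSignal

variable {Ω : Type*} [mΩ : MeasurableSpace Ω] {T ϑ L : ℝ} {μ : Measure Ω} {ℱ : Filtration ℝ mΩ} {A I : ℝ → Ω → ℝ}

theorem measurable_apply (hA : IsRegularSignal T ϑ L μ ℱ A I) {t : ℝ} (ht : t ∈ Icc 0 T) :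
    Measurable (I t) :=
  (hA.isMarkov.adapted t ht).mono (ℱ.le t) le_rfl

theorem measurable_clampPath (hA : IsRegularSignal T ϑ L μ ℱ A I) (hT : 0 ≤ T) :
    Measurable (clampPath T I) := by
  have hm : Measurable fun p : Ω × ℝ =>
      ((⟨max 0 (min p.2 T), le_max_left _ _, max_le hT (min_le_right _ _)⟩ : Icc (0 : ℝ) T),
        p.1) := by
    refine Measurable.prodMk (Measurable.subtype_mk ?_) measurable_fst
    fun_prop
  exact hA.measurable.comp hm

theorem measurable_stepPath (hA : IsRegularSignal T ϑ L μ ℱ A I) (hT : 0 ≤ T) {N : ℕ}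
    (hN : 0 < N) : Measurable (stepPath T N I) := by
  refine Finset.measurable_sum _ fun j hj => ?_
  have h1 : Measurable fun p : Ω × ℝ => I (timeGrid T N j) p.1 :=
    (hA.measurable_apply (timeGrid_mem_Icc hT hN (Finset.mem_range.1 hj).le)).comp measurable_fst
  have : (fun p : Ω × ℝ => (Ico (timeGrid T N j) (timeGrid T N (j + 1))).indicator
      (fun _ => I (timeGrid T N j) p.1) p.2) =
      (Prod.snd ⁻¹' Ico (timeGrid T N j) (timeGrid T N (j + 1))).indicator
        (fun p => I (timeGrid T N j) p.1) := by
    ext p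
    by_cases h : p.2 ∈ Ico (timeGrid T N j) (timeGrid T N (j + 1)) <;> simp [h]
  rw [this]
  exact h1.indicator (measurable_snd measurableSet_Ico)

/-- Uniform moment bounds. -/
theorem exists_moment_bound [IsProbabilityMeasure μ] (hA : IsRegularSignal T ϑ L μ ℱ A I)
    (hϑ : 2 < ϑ) : ∃ b c : ℝ, 0 ≤ b ∧ 0 ≤ c ∧ ∀ t ∈ Icc 0 T, MemLp (I t) 2 μ ∧
      eLpNorm (I t) 2 μ ≤ ENNReal.ofReal c ∧ Integrable (fun ω => |I t ω| ^ ϑ) μ ∧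
      ∫ ω, |I t ω| ^ ϑ ∂μ ≤ b := by
  have hϑ0 : 0 < ϑ := by linarith
  set B := ⨆ t ∈ Icc 0 T, eLpNorm (I t) (ENNReal.ofReal ϑ) μ with hB
  have hle : ∀ t ∈ Icc 0 T, eLpNorm (I t) (ENNReal.ofReal ϑ) μ ≤ B := fun t ht =>
    le_iSup₂ (f := fun t (_ : t ∈ Icc 0 T) => eLpNorm (I t) (ENNReal.ofReal ϑ) μ) t ht
  have hBr : ENNReal.ofReal B.toReal = B := ENNReal.ofReal_toReal hA.bounded.ne
  have h2 : (2 : ℝ≥0∞) ≤ ENNReal.ofReal ϑ := by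
    rw [← ENNReal.ofReal_ofNat]
    exact ENNReal.ofReal_le_ofReal hϑ.le
  refine ⟨B.toReal ^ ϑ, B.toReal, by positivity, by positivity, fun t ht => ?_⟩
  have hm := (hA.measurable_apply ht).aestronglyMeasurable (μ := μ)
  have hLp : MemLp (I t) (ENNReal.ofReal ϑ) μ := ⟨hm, (hle t ht).trans_lt hA.bounded⟩
  have hn := hLp.eLpNorm_eq_integral_rpow_norm (by simpa using hϑ0) (by simp)
  rw [ENNReal.toReal_ofReal hϑ0.le] at hn
  refine ⟨hLp.mono_exponent h2, ?_, ?_, ?_⟩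
  · rw [hBr]
    exact (eLpNorm_le_eLpNorm_of_exponent_le h2 hm).trans (hle t ht)
  · have := hLp.integrable_norm_rpow (by simpa using hϑ0) (by simp)
    simpa [ENNReal.toReal_ofReal hϑ0.le] using this
  · have h0 : 0 ≤ ∫ ω, |I t ω| ^ ϑ ∂μ := integral_nonneg fun ω => by positivity
    have h3 := hle t ht
    rw [hn, ← hBr] at h3
    have h4 := (ENNReal.ofReal_le_ofReal_iff (by positivity)).1 h3
    have h5 := Real.rpow_le_rpow (by positivity) h4 hϑ0.le
    rw [← Real.rpow_mul (integral_nonneg fun ω => by positivity), inv_mul_cancel₀ hϑ0.ne',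
      Real.rpow_one] at h5
    exact h5

theorem eLpNorm_clamp_sub_step_le (hA : IsRegularSignal T ϑ L μ ℱ A I) (hT : 0 < T)
    (hL : 0 ≤ L) {N : ℕ} (hN : 0 < N) :
    ∀ᵐ r ∂(volume.restrict (Ioc 0 T)),
      eLpNorm (fun ω => clampPath T I (ω, r) - stepPath T N I (ω, r)) 2 μ ≤
        ENNReal.ofReal (L * √(T / N)) := by
  -- The half-open grid intervals cover `[0, T)` and miss `T`, which is a null set.
  rw [← restrict_Ico_eq_restrict_Ioc]
  refine (ae_restrict_iff' measurableSet_Ico).2 (ae_of_all _ fun r hr => ?_)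
  obtain ⟨i, hi, hri⟩ := exists_mem_timeGrid hT hN hr.1 hr.2
  have e : (fun ω => clampPath T I (ω, r) - stepPath T N I (ω, r)) =
      fun ω => -(I (timeGrid T N i) - I r) ω := by
    ext ω
    rw [clampPath_of_mem I ⟨hr.1, hr.2.le⟩]
    simp only [stepPath]
    rw [sum_indicator_timeGrid hT.le hi hri fun j => I (timeGrid T N j) ω]
    simp
  rw [e]
  refine (eLpNorm_neg (I (timeGrid T N i) - I r) 2 μ).trans_le ?_
  refine (hA.holder _ (timeGrid_mem_Icc hT.le hN hi.le) r ⟨hri.1, hr.2.le⟩).trans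
    (ENNReal.ofReal_le_ofReal (mul_le_mul_of_nonneg_left ?_ hL))
  rw [← Real.sqrt_eq_rpow]
  refine Real.sqrt_le_sqrt ?_
  rw [abs_sub_comm, abs_of_nonneg (by linarith [hri.1])]
  have := hri.2
  rw [timeGrid_succ] at this
  linarith

theorem eLpNorm_stepError_le [IsProbabilityMeasure μ] (hA : IsRegularSignal T ϑ L μ ℱ A I)
    (hT : 0 < T) (hL : 0 ≤ L) {N : ℕ} (hN : 0 < N) :
    eLpNorm (stepError T N I) 2 μ ≤ ENNReal.ofReal (T * (L * √(T / N))) := by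
  have hm : Measurable fun p => clampPath T I p - stepPath T N I p :=
    (hA.measurable_clampPath hT.le).sub (hA.measurable_stepPath hT.le hN)
  have hb := hA.eLpNorm_clamp_sub_step_le hT hL hN
  have h := eLpNorm_integral_abs_le (μ := μ) (T := T) (c := L * √(T / N))
    (h := fun p => clampPath T I p - stepPath T N I p) hT.le hm hb
  unfold stepError
  exact h

theorem aestronglyMeasurable_stepError (hA : IsRegularSignal T ϑ L μ ℱ A I)
    (hT : 0 < T) {N : ℕ} (hN : 0 < N) :
    AEStronglyMeasurable (stepError T N I) μ :=
  (StronglyMeasurable.integral_prod_right' (ν := volume.restrict (Ioc 0 T))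
    ((hA.measurable_clampPath hT.le).sub
      (hA.measurable_stepPath hT.le hN)).abs.stronglyMeasurable).aestronglyMeasurable

theorem memLp_stepError [IsProbabilityMeasure μ] (hA : IsRegularSignal T ϑ L μ ℱ A I)
    (hT : 0 < T) (hL : 0 ≤ L) {N : ℕ} (hN : 0 < N) : MemLp (stepError T N I) 2 μ :=
  ⟨hA.aestronglyMeasurable_stepError hT hN, (hA.eLpNorm_stepError_le hT hL hN).trans_lt (by simp)⟩

theorem integrable_clampPath [IsProbabilityMeasure μ] (hA : IsRegularSignal T ϑ L μ ℱ A I)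
    (hT : 0 < T) (hϑ : 2 < ϑ) :
    Integrable (clampPath T I) (μ.prod (volume.restrict (Ioc 0 T))) := by
  obtain ⟨b, c, -, -, h⟩ := hA.exists_moment_bound hϑ
  refine integrable_prod_of_eLpNorm_le (c := c) (hA.measurable_clampPath hT.le) ?_
  refine (ae_restrict_iff' measurableSet_Ioc).2 (ae_of_all _ fun r hr => ?_)
  have hr' : r ∈ Icc 0 T := Ioc_subset_Icc_self hr
  simp_rw [clampPath_of_mem I hr']
  exact (h r hr').2.1

theorem ae_integrable [IsProbabilityMeasure μ] (hA : IsRegularSignal T ϑ L μ ℱ A I)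
    (hT : 0 < T) (hϑ : 2 < ϑ) :
    ∀ᵐ ω ∂μ, IntegrableOn (fun r => clampPath T I (ω, r)) (Ioc 0 T) :=
  (hA.integrable_clampPath hT hϑ).prod_right_ae

theorem ae_signal_sub_eq [IsProbabilityMeasure μ] (hA : IsRegularSignal T ϑ L μ ℱ A I)
    (hT : 0 < T) (hϑ : 2 < ϑ) :
    ∀ᵐ ω ∂μ, ∀ t ∈ Icc 0 T, ∀ s ∈ Icc t T, A s ω - A t ω = ∫ r in t..s, clampPath T I (ω, r) := by
  filter_upwards [hA.ae_integrable hT hϑ, hA.signal_eq] with ω h1 h2 t ht s hs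
  have hs0 : s ∈ Icc 0 T := ⟨ht.1.trans hs.1, hs.2⟩
  have e : ∀ u ∈ Icc 0 T, A u ω = ∫ r in (0 : ℝ)..u, clampPath T I (ω, r) := fun u hu => by
    rw [h2 u hu]
    refine intervalIntegral.integral_congr fun r hr => ?_
    rw [uIcc_of_le hu.1] at hr
    exact (clampPath_of_mem I ⟨hr.1, hr.2.trans hu.2⟩ ω).symm
  have hi : ∀ u ∈ Icc 0 T, IntervalIntegrable (fun r => clampPath T I (ω, r)) volume 0 u :=
    fun u hu => (intervalIntegrable_iff_integrableOn_Ioc_of_le hu.1).2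
      (h1.mono_set (Ioc_subset_Ioc_right hu.2))
  rw [e s hs0, e t ht, intervalIntegral.integral_interval_sub_left (hi s hs0) (hi t ht)]

/-- The increments of the signal are Riemann sums up to the step error. -/
theorem ae_abs_signal_sub_le [IsProbabilityMeasure μ] (hA : IsRegularSignal T ϑ L μ ℱ A I)
    (hT : 0 < T) (hϑ : 2 < ϑ) (N : ℕ) :
    ∀ᵐ ω ∂μ, ∀ t ∈ Icc 0 T, ∀ s ∈ Icc t T,
      |A s ω - A t ω - ∑ j ∈ Finset.range N, gridWeight T N t s j * I (timeGrid T N j) ω| ≤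
        stepError T N I ω := by
  filter_upwards [hA.ae_integrable hT hϑ, hA.ae_signal_sub_eq hT hϑ] with ω h1 h2 t ht s hs
  have hs0 : s ∈ Icc 0 T := ⟨ht.1.trans hs.1, hs.2⟩
  have hst : Integrable (fun r => stepPath T N I (ω, r)) :=
    integrable_finsetSum _ fun j _ =>
      integrable_indicator_Ico (timeGrid T N j) (timeGrid T N (j + 1)) (I (timeGrid T N j) ω)
  have hsub : Ioc t s ⊆ Ioc 0 T := Ioc_subset_Ioc ht.1 hs.2
  have hd : IntegrableOn (fun r => clampPath T I (ω, r) - stepPath T N I (ω, r)) (Ioc 0 T) :=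
    h1.sub hst.integrableOn
  have hJ : IntervalIntegrable (fun r => clampPath T I (ω, r)) volume t s :=
    (intervalIntegrable_iff_integrableOn_Ioc_of_le hs.1).2 (h1.mono_set hsub)
  rw [h2 t ht s hs, ← integral_sum_indicator_timeGrid]
  change |(∫ r in t..s, clampPath T I (ω, r)) - ∫ r in t..s, stepPath T N I (ω, r)| ≤ _
  rw [← intervalIntegral.integral_sub hJ hst.intervalIntegrable,
    intervalIntegral.integral_of_le hs.1]
  refine abs_integral_le_integral_abs.trans ?_
  exact setIntegral_mono_set hd.abs (ae_of_all _ fun _ => abs_nonneg _) hsub.eventuallyLE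

end IsRegularSignal

end LSMC

/-! ### Conditional expectations of the signal -/

namespace LSMC

variable {Ω : Type*} [mΩ : MeasurableSpace Ω]

namespace IsRegularSignal

variable {T ϑ L : ℝ} {μ : Measure Ω} {ℱ : Filtration ℝ mΩ} {A I : ℝ → Ω → ℝ}

theorem ae_signal_eq [IsProbabilityMeasure μ] (hA : IsRegularSignal T ϑ L μ ℱ A I)
    (hT : 0 < T) (hϑ : 2 < ϑ) {t : ℝ} (ht : t ∈ Icc 0 T) :
    A t =ᵐ[μ] fun ω => ∫ r in (0 : ℝ)..t, clampPath T I (ω, r) := by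
  filter_upwards [hA.ae_signal_sub_eq hT hϑ, hA.signal_eq] with ω h1 h2
  have h0 : A 0 ω = 0 := by simp [h2 0 ⟨le_rfl, hT.le⟩]
  simpa [h0] using h1 0 ⟨le_rfl, hT.le⟩ t ht

theorem integrable_signal [IsProbabilityMeasure μ] (hA : IsRegularSignal T ϑ L μ ℱ A I)
    (hT : 0 < T) (hϑ : 2 < ϑ) {t : ℝ} (ht : t ∈ Icc 0 T) : Integrable (A t) μ := by
  refine Integrable.congr ?_ (hA.ae_signal_eq hT hϑ ht).symm
  simp_rw [intervalIntegral.integral_of_le ht.1]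
  have : Integrable (clampPath T I) (μ.prod (volume.restrict (Ioc 0 t))) :=
    (hA.integrable_clampPath hT hϑ).mono_measure
      (Measure.prod_mono le_rfl (Measure.restrict_mono (Ioc_subset_Ioc_right ht.2) le_rfl))
  exact this.integral_prod_left

theorem integrable_apply [IsProbabilityMeasure μ] (hA : IsRegularSignal T ϑ L μ ℱ A I)
    (hϑ : 2 < ϑ) {t : ℝ} (ht : t ∈ Icc 0 T) : Integrable (I t) μ := by
  obtain ⟨b, c, -, -, h⟩ := hA.exists_moment_bound hϑ
  exact (h t ht).1.integrable (by norm_num)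

/-- A path-continuous version of the conditional expectations exists. -/
theorem exists_isCondSignal [IsProbabilityMeasure μ] (hA : IsRegularSignal T ϑ L μ ℱ A I)
    (hT : 0 < T) (hϑ : 2 < ϑ) : ∃ Y : ℝ → ℝ → Ω → ℝ, IsCondSignal T μ ℱ A Y := by
  have h := fun t => exists_continuous_condExp_integral (ℱ.le t) (hA.integrable_clampPath hT hϑ)
  choose Y hY hYc using h
  refine ⟨Y, fun t ht s hs => ?_, fun t _ => (hYc t).mono fun ω hω => hω.continuousOn⟩
  have hs0 : s ∈ Icc 0 T := ⟨ht.1.trans hs.1, hs.2⟩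
  exact (hY t s hs0).trans (condExp_congr_ae (hA.ae_signal_eq hT hϑ hs0).symm)

/-- Grid times after `t` carry zero weight, so only values of `I` known at time `t` enter. -/
theorem stronglyMeasurable_riemannSum (hA : IsRegularSignal T ϑ L μ ℱ A I) (hT : 0 < T) {N : ℕ}
    (hN : 0 < N) {t : ℝ} (ht : t ∈ Icc 0 T) :
    StronglyMeasurable[ℱ t]
      (∑ j ∈ Finset.range N, fun ω => gridWeight T N 0 t j * I (timeGrid T N j) ω) := by
  refine Finset.stronglyMeasurable_sum _ fun j hj => ?_
  have hj0 := timeGrid_mem_Icc hT.le hN (Finset.mem_range.1 hj).le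
  rcases le_or_gt (timeGrid T N j) t with h | h
  · exact (((hA.isMarkov.adapted _ hj0).mono (ℱ.mono h) le_rfl).const_mul _).stronglyMeasurable
  · simp only [gridWeight_eq_zero N ht.1 (Or.inr h.le), zero_mul]
    exact stronglyMeasurable_const

/-- The signal is adapted up to null sets. -/
theorem condExp_signal_self [IsProbabilityMeasure μ] (hA : IsRegularSignal T ϑ L μ ℱ A I)
    (hT : 0 < T) (hϑ : 2 < ϑ) (hL : 0 ≤ L) {t : ℝ} (ht : t ∈ Icc 0 T) :
    μ[A t | ℱ t] =ᵐ[μ] A t := by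
  have hAi := hA.integrable_signal hT hϑ ht
  -- `A t` is within the step error of an `ℱ t`-measurable Riemann sum, and so is its conditional
  -- expectation; hence the factor 2. Adaptedness of `I` at single times suffices.
  have hbound : ∀ N : ℕ, 0 < N → eLpNorm (A t - μ[A t | ℱ t]) 2 μ ≤
      ENNReal.ofReal (2 * (T * (L * √(T / N)))) := fun N hN => by
    set S : Ω → ℝ := ∑ j ∈ Finset.range N, fun ω => gridWeight T N 0 t j * I (timeGrid T N j) ω
      with hS
    have hSm : StronglyMeasurable[ℱ t] S := hA.stronglyMeasurable_riemannSum hT hN ht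
    have hSi : Integrable S μ := integrable_finsetSum' _ fun j hj =>
      (hA.integrable_apply hϑ (timeGrid_mem_Icc hT.le hN (Finset.mem_range.1 hj).le)).const_mul _
    have hAS : eLpNorm (A t - S) 2 μ ≤ ENNReal.ofReal (T * (L * √(T / N))) := by
      refine (eLpNorm_mono_ae_real (g := stepError T N I) ?_).trans
        (hA.eLpNorm_stepError_le hT hL hN)
      filter_upwards [hA.ae_abs_signal_sub_le hT hϑ N, hA.signal_eq] with ω h1 h2
      have h0 : A 0 ω = 0 := by simp [h2 0 ⟨le_rfl, hT.le⟩]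
      simpa [h0, hS] using h1 0 ⟨le_rfl, hT.le⟩ t ht
    have e : A t - μ[A t | ℱ t] =ᵐ[μ] fun ω => (A t - S) ω + (-μ[A t - S | ℱ t]) ω := by
      filter_upwards [condExp_sub hAi hSi (ℱ t)] with ω h1
      rw [condExp_of_stronglyMeasurable (ℱ.le t) hSm hSi] at h1
      simp only [Pi.sub_apply, Pi.neg_apply] at h1 ⊢
      rw [h1]
      ring
    rw [eLpNorm_congr_ae e, two_mul]
    have h0 : 0 ≤ T * (L * √(T / N)) := by positivity
    refine eLpNorm_add_le_ofReal (hAi.sub hSi).aestronglyMeasurable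
      integrable_condExp.neg.aestronglyMeasurable h0 h0 hAS ?_
    rw [eLpNorm_neg]
    exact (eLpNorm_condExp_le_eLpNorm _ (by norm_num)).trans hAS
  have hlim : Tendsto (fun N : ℕ => ENNReal.ofReal (2 * (T * (L * √(T / N))))) atTop (𝓝 0) := by
    rw [← ENNReal.ofReal_zero]
    refine ENNReal.tendsto_ofReal ?_
    have h1 : Tendsto (fun N : ℕ => √(T / (N : ℝ))) atTop (𝓝 √0) :=
      (Real.continuous_sqrt.tendsto 0).comp (tendsto_const_div_atTop_nhds_zero_nat T)
    simpa using ((h1.const_mul L).const_mul T).const_mul 2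
  have hzero : eLpNorm (A t - μ[A t | ℱ t]) 2 μ = 0 := by
    refine le_antisymm (ge_of_tendsto hlim ?_) zero_le
    filter_upwards [eventually_gt_atTop 0] with N hN using hbound N hN
  rw [eLpNorm_eq_zero_iff (hAi.sub integrable_condExp).aestronglyMeasurable (by norm_num)] at hzero
  filter_upwards [hzero] with ω hω
  simp only [Pi.sub_apply, Pi.zero_apply, sub_eq_zero] at hω
  exact hω.symm

/-- The Markov property, assumed for indicators only, extends to the integrable variable `I r`, and
the transition expectation is a version of conditioning on `I t`. -/
theorem condExp_eq_transition [IsProbabilityMeasure μ] (hA : IsRegularSignal T ϑ L μ ℱ A I)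
    (hϑ : 2 < ϑ) {φ : ℝ → ℝ → ℝ → ℝ} (hφ : IsTransitionExpectation T μ I φ)
    {t r : ℝ} (ht : t ∈ Icc 0 T) (hr : r ∈ Icc t T) :
    μ[I r | ℱ t] =ᵐ[μ] fun ω => φ t r (I t ω) := by
  have hr0 : r ∈ Icc 0 T := ⟨ht.1.trans hr.1, hr.2⟩
  exact (condExp_eq_of_forall_indicator (hA.measurable_apply hr0) (hA.integrable_apply hϑ hr0)
    (hA.isMarkov.markov t ht r hr)).trans (hφ t ht r hr).2.symm

/-- Up to the conditional step error, conditional increments of the signal are Riemann sums of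
conditional expectations, uniformly in the final time. -/
theorem ae_abs_condSignal_sub_le [IsProbabilityMeasure μ] (hA : IsRegularSignal T ϑ L μ ℱ A I)
    (hT : 0 < T) (hϑ : 2 < ϑ) (hL : 0 ≤ L) {Y : ℝ → ℝ → Ω → ℝ} (hY : IsCondSignal T μ ℱ A Y)
    {N : ℕ} (hN : 0 < N) {t : ℝ} (ht : t ∈ Icc 0 T) :
    ∀ᵐ ω ∂μ, ∀ s ∈ Icc t T, |Y t s ω - A t ω -
      ∑ j ∈ Finset.range N, gridWeight T N t s j * (μ[I (timeGrid T N j) | ℱ t]) ω| ≤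
        (μ[stepError T N I | ℱ t]) ω := by
  have hDi : Integrable (stepError T N I) μ := (hA.memLp_stepError hT hL hN).integrable (by norm_num)
  -- The bound does not depend on `s`, so it suffices to prove it for each fixed `s`: path
  -- continuity of `Y` and continuity of the weights make it uniform.
  refine ae_forall_le_of_continuousOn (fun s hs => ?_) ?_
  · have hs0 : s ∈ Icc 0 T := ⟨ht.1.trans hs.1, hs.2⟩
    have hIi : ∀ j ∈ Finset.range N, Integrable (I (timeGrid T N j)) μ := fun j hj =>
      hA.integrable_apply hϑ (timeGrid_mem_Icc hT.le hN (Finset.mem_range.1 hj).le)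
    have hwi : ∀ j ∈ Finset.range N, Integrable (gridWeight T N t s j • I (timeGrid T N j)) μ :=
      fun j hj => (hIi j hj).smul _
    set S : Ω → ℝ := ∑ j ∈ Finset.range N, gridWeight T N t s j • I (timeGrid T N j) with hS
    have hSi : Integrable S μ := integrable_finsetSum' _ hwi
    have hAsi := hA.integrable_signal hT hϑ hs0
    have hAti := hA.integrable_signal hT hϑ ht
    have hXi : Integrable (A s - A t - S) μ := (hAsi.sub hAti).sub hSi
    have hle : ∀ᵐ ω ∂μ, |(A s - A t - S) ω| ≤ stepError T N I ω := by
      filter_upwards [hA.ae_abs_signal_sub_le hT hϑ N] with ω h1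
      simpa [hS] using h1 t ht s hs
    have hcS : μ[S | ℱ t] =ᵐ[μ] fun ω =>
        ∑ j ∈ Finset.range N, gridWeight T N t s j * (μ[I (timeGrid T N j) | ℱ t]) ω := by
      have h1 : ∀ᵐ ω ∂μ, ∀ j ∈ Finset.range N, (μ[gridWeight T N t s j • I (timeGrid T N j) | ℱ t]) ω
          = gridWeight T N t s j * (μ[I (timeGrid T N j) | ℱ t]) ω := by
        refine (Finset.eventually_all _).2 fun j _ => ?_
        exact condExp_smul (gridWeight T N t s j) (I (timeGrid T N j)) (ℱ t)
      filter_upwards [condExp_finsetSum hwi (ℱ t), h1] with ω h2 h3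
      rw [h2, Finset.sum_apply]
      exact Finset.sum_congr rfl h3
    filter_upwards [hY.ae_eq t ht s hs, hA.condExp_signal_self hT hϑ hL ht, hcS,
      condExp_sub (hAsi.sub hAti) hSi (ℱ t), condExp_sub hAsi hAti (ℱ t),
      condExp_mono (m := ℱ t) hXi hDi (hle.mono fun ω h => (le_abs_self _).trans h),
      condExp_mono (m := ℱ t) hXi.neg hDi (hle.mono fun ω h => (neg_le_abs _).trans h),
      condExp_neg (A s - A t - S) (ℱ t) (μ := μ)] with ω h1 h2 h3 h4 h5 h6 h7 h8
    rw [h8] at h7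
    simp only [Pi.sub_apply, Pi.neg_apply] at h4 h5 h7
    rw [h4, h5, h2, h3, ← h1] at h6 h7
    exact abs_le'.2 ⟨h6, h7⟩
  · filter_upwards [hY.continuousOn t ht] with ω hω
    refine ((hω.sub continuousOn_const).sub ?_).abs
    exact (continuous_finsetSum _ fun j _ =>
      (continuous_gridWeight T N t j).mul continuous_const).continuousOn

/-- Replacing the current state by the state at the last grid time. -/
theorem eLpNorm_condExp_sub_transition_le [IsProbabilityMeasure μ]
    (hA : IsRegularSignal T ϑ L μ ℱ A I) (hT : 0 < T) (hϑ : 2 < ϑ) (hL : 0 ≤ L) {c : ℝ}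
    (hc : 0 ≤ c) (hIc : ∀ t ∈ Icc 0 T, eLpNorm (I t) 2 μ ≤ ENNReal.ofReal c)
    {φ : ℝ → ℝ → ℝ → ℝ} (hφ : IsTransitionExpectation T μ I φ)
    (hφL : ∀ t ∈ Icc 0 T, ∀ s ∈ Icc t T, ∀ r ∈ Icc s T, ∀ x y : ℝ,
      |φ t r x - φ s r y| ≤ L * (|x - y| + |t - s| ^ (1 / 2 : ℝ) * (1 + |x| + |y|)))
    {N i j : ℕ} (hN : 0 < N) (hij : i ≤ j) (hj : j < N) {t : ℝ} (ht : t ∈ Icc 0 T)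
    (hti : t ∈ Ico (timeGrid T N i) (timeGrid T N (i + 1))) :
    eLpNorm (fun ω => (μ[I (timeGrid T N j) | ℱ t]) ω -
      φ (timeGrid T N i) (timeGrid T N j) (I (timeGrid T N i) ω)) 2 μ ≤
      ENNReal.ofReal (L * (L + 1 + 2 * c) * √(T / N)) := by
  have hi0 := timeGrid_mem_Icc hT.le hN (hij.trans hj.le)
  have hj0 := timeGrid_mem_Icc hT.le hN hj.le
  have hjmem : timeGrid T N j ∈ Icc (timeGrid T N i) T := ⟨monotone_timeGrid hT.le N hij, hj0.2⟩
  -- For `i = j` the target time is at or before `t`, so the transition bound does not apply; but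
  -- then `I` at that time is already known and the difference vanishes almost surely. For `i < j`
  -- one has `t < timeGrid T N (i + 1) ≤ timeGrid T N j`.
  rcases hij.eq_or_lt with rfl | hlt
  · have h1 : μ[I (timeGrid T N i) | ℱ t] = I (timeGrid T N i) :=
      condExp_of_stronglyMeasurable (ℱ.le t)
        ((hA.isMarkov.adapted _ hi0).mono (ℱ.mono hti.1) le_rfl).stronglyMeasurable
        (hA.integrable_apply hϑ hi0)
    have h2 : μ[I (timeGrid T N i) | MeasurableSpace.comap (I (timeGrid T N i)) inferInstance] =
        I (timeGrid T N i) :=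
      condExp_of_stronglyMeasurable (hA.measurable_apply hi0).comap_le
        (comap_measurable _).stronglyMeasurable (hA.integrable_apply hϑ hi0)
    have h3 := (hφ _ hi0 _ hjmem).2
    rw [h2] at h3
    have e : (fun ω => (μ[I (timeGrid T N i) | ℱ t]) ω -
      φ (timeGrid T N i) (timeGrid T N i) (I (timeGrid T N i) ω)) =ᵐ[μ] fun _ => 0 := by
      filter_upwards [h3] with ω hω
      rw [hω, h1, sub_self]
    rw [eLpNorm_congr_ae e, eLpNorm_zero']
    exact zero_le
  · have htj : timeGrid T N j ∈ Icc t T :=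
      ⟨hti.2.le.trans (monotone_timeGrid hT.le N hlt), hj0.2⟩
    have htmem : t ∈ Icc (timeGrid T N i) T := ⟨hti.1, ht.2⟩
    set ti := timeGrid T N i with htid
    have hd : |ti - t| ^ (1 / 2 : ℝ) ≤ √(T / N) := by
      rw [← Real.sqrt_eq_rpow]
      refine Real.sqrt_le_sqrt ?_
      have := hti.2
      rw [timeGrid_succ] at this
      rw [abs_sub_comm, abs_of_nonneg (by linarith [hti.1])]
      linarith
    have hm1 : AEStronglyMeasurable (fun ω => |(I ti - I t) ω|) μ :=
      ((hA.measurable_apply hi0).sub (hA.measurable_apply ht)).abs.aestronglyMeasurable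
    have hm2 : AEStronglyMeasurable (fun ω => |I ti ω|) μ :=
      (hA.measurable_apply hi0).abs.aestronglyMeasurable
    have hm3 : AEStronglyMeasurable (fun ω => |I t ω|) μ :=
      (hA.measurable_apply ht).abs.aestronglyMeasurable
    have hm4 : AEStronglyMeasurable (fun _ : Ω => (1 : ℝ)) μ := aestronglyMeasurable_const
    have hq0 : 0 ≤ √(T / N) := Real.sqrt_nonneg _
    have n1 : eLpNorm (fun ω => |(I ti - I t) ω|) 2 μ ≤ ENNReal.ofReal (L * √(T / N)) := by
      rw [eLpNorm_abs]
      exact (hA.holder _ hi0 _ htmem).trans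
        (ENNReal.ofReal_le_ofReal (mul_le_mul_of_nonneg_left hd hL))
    have n2 := (eLpNorm_abs μ (I ti) 2).trans_le (hIc _ hi0)
    have n3 := (eLpNorm_abs μ (I t) 2).trans_le (hIc _ ht)
    have n4 := eLpNorm_add_le_ofReal (hm4.add hm2) hm3 (by positivity) hc
      (eLpNorm_add_le_ofReal hm4 hm2 zero_le_one hc (eLpNorm_const_le_ofReal zero_le_one) n2) n3
    have n5 : eLpNorm (fun ω => √(T / N) * (1 + |I ti ω| + |I t ω|)) 2 μ ≤
        ENNReal.ofReal (√(T / N) * (1 + c + c)) := by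
      rw [ENNReal.ofReal_mul hq0]
      refine (eLpNorm_const_smul_le (c := √(T / N)) (f := fun ω => 1 + |I ti ω| + |I t ω|)).trans ?_
      rw [Real.enorm_of_nonneg hq0]
      exact mul_le_mul_right n4 _
    have n6 := eLpNorm_add_le_ofReal hm1 (((hm4.add hm2).add hm3).const_mul √(T / N))
      (by positivity) (by positivity) n1 n5
    have n7 : eLpNorm (fun ω => L * (|(I ti - I t) ω| + √(T / N) * (1 + |I ti ω| + |I t ω|))) 2 μ ≤
        ENNReal.ofReal (L * (L * √(T / N) + √(T / N) * (1 + c + c))) := by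
      rw [ENNReal.ofReal_mul hL]
      refine (eLpNorm_const_smul_le (c := L) (f := fun ω =>
        |(I ti - I t) ω| + √(T / N) * (1 + |I ti ω| + |I t ω|))).trans ?_
      rw [Real.enorm_of_nonneg hL]
      exact mul_le_mul_right n6 _
    have e : L * (L + 1 + 2 * c) * √(T / N) = L * (L * √(T / N) + √(T / N) * (1 + c + c)) := by
      ring
    rw [e]
    refine (eLpNorm_mono_ae_real ?_).trans n7
    filter_upwards [hA.condExp_eq_transition hϑ hφ ht htj] with ω hω
    rw [hω, Real.norm_eq_abs, abs_sub_comm]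
    refine (hφL _ hi0 _ htmem _ htj _ _).trans (mul_le_mul_of_nonneg_left ?_ hL)
    have h0 : 0 ≤ 1 + |I ti ω| + |I t ω| := by positivity
    exact add_le_add le_rfl (mul_le_mul_of_nonneg_right hd h0)

end IsRegularSignal

end LSMC

namespace LSMC

variable {Ω : Type*} [mΩ : MeasurableSpace Ω]

/-! ### The error bound -/

/-- The regression error at a pair of grid times. -/
theorem exists_grid_regression_majorant {μ : Measure Ω} [IsProbabilityMeasure μ] {T ϑ L : ℝ}
    (hT : 0 < T) (hϑ : 2 < ϑ) (hL : 0 ≤ L) {ℱ : Filtration ℝ mΩ} {A I : ℝ → Ω → ℝ}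
    (hA : IsRegularSignal T ϑ L μ ℱ A I) {Ic : ℕ → ℝ → Ω → ℝ} (hIc : IsIndepCopies T μ I Ic)
    {b : ℝ} (hb : 0 ≤ b) (hmom : ∀ t ∈ Icc 0 T, MemLp (I t) 2 μ ∧
      Integrable (fun ω => |I t ω| ^ ϑ) μ ∧ ∫ ω, |I t ω| ^ ϑ ∂μ ≤ b)
    {φ : ℝ → ℝ → ℝ → ℝ} (hφ : IsTransitionExpectation T μ I φ)
    (hφL : ∀ t ∈ Icc 0 T, ∀ s ∈ Icc t T, ∀ r ∈ Icc s T, ∀ x y : ℝ,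
      |φ t r x - φ s r y| ≤ L * (|x - y| + |t - s| ^ (1 / 2 : ℝ) * (1 + |x| + |y|)))
    {N M K : ℕ} (hN : 0 < N) (hM : 0 < M) (hK : 0 < K) {R : ℝ} (hR : 0 < R)
    {ψ : ℕ → ℕ → Ω → ℝ → ℝ} (hψ : IsRegression T N M K R Ic ψ) {i j : ℕ} (hij : i ≤ j)
    (hj : j < N) :
    ∃ H : Ω → ℝ, AEStronglyMeasurable H μ ∧
      eLpNorm H 2 μ ≤ ENNReal.ofReal (2 * R * √(K / M) + L * (R / K) +
        (√b + √((2 ^ ϑ + 1) * b)) * R ^ (-((ϑ - 2) / 2))) ∧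
      ∀ᵐ ω ∂μ, |trunc R (ψ i j ω (I (timeGrid T N i) ω)) -
        φ (timeGrid T N i) (timeGrid T N j) (I (timeGrid T N i) ω)| ≤ H ω := by
  have hi0 := timeGrid_mem_Icc hT.le hN (hij.trans hj.le)
  have hj0 := timeGrid_mem_Icc hT.le hN hj.le
  have hjmem : timeGrid T N j ∈ Icc (timeGrid T N i) T := ⟨monotone_timeGrid hT.le N hij, hj0.2⟩
  set ti := timeGrid T N i
  set tj := timeGrid T N j
  -- Evaluation at the two grid times carries independence and equality of laws from path space to
  -- pairs.
  set ev : (Icc (0 : ℝ) T → ℝ) → ℝ × ℝ := fun p => (p ⟨ti, hi0⟩, p ⟨tj, hj0⟩) with hev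
  have hevm : Measurable ev := (measurable_pi_apply _).prodMk (measurable_pi_apply _)
  have hpm : ∀ k : Option ℕ, Measurable (path T (k.elim I Ic)) := fun k => by
    refine measurable_pi_iff.2 fun t => ?_
    cases k with
    | none => exact hA.measurable_apply t.2
    | some m => exact hIc.measurable m t t.2
  obtain ⟨H, hHm, -, hHn, hHb⟩ := exists_regression_majorant (μ := μ)
    (P := fun k => ev ∘ path T (k.elim I Ic)) (X := I ti) (Y := I tj) (f := φ ti tj) (ψ := ψ i j)
    (b := b) (R := R) (K := K) (M := M) (ϑ := ϑ) (L := L)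
    (fun k => hevm.comp (hpm k)) (hIc.indep.comp (fun _ => ev) fun _ => hevm)
    (fun m => (hIc.identDistrib m).comp hevm) hϑ.le hb hL hR rfl (hmom tj hj0).1
    (hmom ti hi0).2.1 (hmom ti hi0).2.2 (hmom tj hj0).2.1 (hmom tj hj0).2.2
    -- With equal starting times the time term of the transition bound vanishes, and what is left is
    -- Lipschitz continuity in the state.
    (fun x y => by simpa using hφL ti hi0 ti ⟨le_rfl, hi0.2⟩ tj hjmem x y)
    (hφ ti hi0 tj hjmem).2 hK hM (fun ω => hψ i j hij hj.le ω)
  exact ⟨H, hHm, hHn, hHb⟩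

theorem eLpNorm_sum_le_ofReal {μ : Measure Ω} {ι : Type*} (s : Finset ι) {f : ι → Ω → ℝ} {a : ℝ}
    (hf : ∀ i ∈ s, AEStronglyMeasurable (f i) μ)
    (h : ∀ i ∈ s, eLpNorm (f i) 2 μ ≤ ENNReal.ofReal a) :
    eLpNorm (∑ i ∈ s, f i) 2 μ ≤ ENNReal.ofReal (s.card * a) := by
  refine (eLpNorm_sum_le hf (by norm_num)).trans ((Finset.sum_le_card_nsmul _ _ _ h).trans_eq ?_)
  rw [nsmul_eq_mul, ENNReal.ofReal_mul (by positivity), ENNReal.ofReal_natCast]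

/-- The error at a fixed time. -/
theorem eLpNorm_iSup_le {μ : Measure Ω} [IsProbabilityMeasure μ] {T ϑ L : ℝ}
    (hT : 0 < T) (hϑ : 2 < ϑ) (hL : 0 ≤ L) {ℱ : Filtration ℝ mΩ} {A I : ℝ → Ω → ℝ}
    (hA : IsRegularSignal T ϑ L μ ℱ A I) {Y : ℝ → ℝ → Ω → ℝ} (hY : IsCondSignal T μ ℱ A Y)
    {φ : ℝ → ℝ → ℝ → ℝ} (hφ : IsTransitionExpectation T μ I φ)
    {N : ℕ} (hN : 0 < N) {R : ℝ} {ψ : ℕ → ℕ → Ω → ℝ → ℝ} {t : ℝ} (ht : t ∈ Icc 0 T)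
    {i : ℕ} (hi : i < N) (hti : t ∈ Ico (timeGrid T N i) (timeGrid T N (i + 1)))
    {κ ρ : ℝ} (hκ : 0 ≤ κ) (hρ : 0 ≤ ρ)
    (hg : ∀ j, i ≤ j → j < N → eLpNorm (fun ω => (μ[I (timeGrid T N j) | ℱ t]) ω -
      φ (timeGrid T N i) (timeGrid T N j) (I (timeGrid T N i) ω)) 2 μ ≤ ENNReal.ofReal κ)
    (hH : ∀ j, i ≤ j → j < N → ∃ H : Ω → ℝ, AEStronglyMeasurable H μ ∧
      eLpNorm H 2 μ ≤ ENNReal.ofReal ρ ∧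
      ∀ᵐ ω ∂μ, |trunc R (ψ i j ω (I (timeGrid T N i) ω)) -
        φ (timeGrid T N i) (timeGrid T N j) (I (timeGrid T N i) ω)| ≤ H ω) :
    eLpNorm (fun ω => ⨆ s ∈ Icc t T,
      ‖Y t s ω - (A t ω + ∫ r in t..s, regressionProcess T N R I ψ t r ω)‖ₑ) 2 μ ≤
      ENNReal.ofReal (T * (L * √(T / N)) + T * (κ + ρ)) := by
  choose! H hHm hHn hHb using hH
  set g : ℕ → Ω → ℝ := fun j ω => (μ[I (timeGrid T N j) | ℱ t]) ω -
      φ (timeGrid T N i) (timeGrid T N j) (I (timeGrid T N i) ω) with hgd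
  have hi0 := timeGrid_mem_Icc hT.le hN hi.le
  have hgm : ∀ j, i ≤ j → j < N → AEStronglyMeasurable (g j) μ := fun j hij hj => by
    have hj0 := timeGrid_mem_Icc hT.le hN hj.le
    have h1 := (hφ _ hi0 (timeGrid T N j) ⟨monotone_timeGrid hT.le N hij, hj0.2⟩).1
    exact integrable_condExp.aestronglyMeasurable.sub
      (h1.comp (hA.measurable_apply hi0)).aestronglyMeasurable
  set s₀ := (Finset.range N).filter fun j => i ≤ j with hs₀
  have hmem : ∀ j ∈ s₀, i ≤ j ∧ j < N := fun j hj => by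
    rw [hs₀, Finset.mem_filter, Finset.mem_range] at hj
    exact ⟨hj.2, hj.1⟩
  have hTN : 0 ≤ T / N := by positivity
  -- Bounding each weight by `T / N` removes `s`, so the supremum over `s` can be taken before the
  -- norm. At most `N` terms appear, hence the total factor `T`.
  set F : ℕ → Ω → ℝ := fun j ω => T / N * (|g j ω| + H j ω) with hF
  have hFm : ∀ j ∈ s₀, AEStronglyMeasurable (F j) μ := fun j hj =>
    (((hgm j (hmem j hj).1 (hmem j hj).2).norm).add
      (hHm j (hmem j hj).1 (hmem j hj).2)).const_mul _
  have hFn : ∀ j ∈ s₀, eLpNorm (F j) 2 μ ≤ ENNReal.ofReal (T / N * (κ + ρ)) := fun j hj => by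
    obtain ⟨h1, h2⟩ := hmem j hj
    have hn := eLpNorm_add_le_ofReal (f := fun ω => |g j ω|) (g := H j) (hgm j h1 h2).norm
      (hHm j h1 h2) hκ hρ
      ((eLpNorm_abs μ (g j) 2).trans_le (hg j h1 h2)) (hHn j h1 h2)
    rw [ENNReal.ofReal_mul hTN]
    refine (eLpNorm_const_smul_le (c := T / (N : ℝ)) (f := fun ω => |g j ω| + H j ω)).trans ?_
    rw [Real.enorm_of_nonneg hTN]
    exact mul_le_mul_right hn _
  have hFs : eLpNorm (∑ j ∈ s₀, F j) 2 μ ≤ ENNReal.ofReal (T * (κ + ρ)) := by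
    refine (eLpNorm_sum_le_ofReal s₀ hFm hFn).trans (ENNReal.ofReal_le_ofReal ?_)
    have hcard : (s₀.card : ℝ) ≤ N := by
      exact_mod_cast (Finset.card_filter_le _ _).trans_eq (Finset.card_range N)
    have hN' : (N : ℝ) ≠ 0 := by positivity
    calc (s₀.card : ℝ) * (T / N * (κ + ρ)) ≤ N * (T / N * (κ + ρ)) := by gcongr
      _ = T * (κ + ρ) := by field_simp
  have hD : eLpNorm (μ[stepError T N I | ℱ t]) 2 μ ≤ ENNReal.ofReal (T * (L * √(T / N))) :=
    (eLpNorm_condExp_le_eLpNorm _ (by norm_num)).trans (hA.eLpNorm_stepError_le hT hL hN)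
  refine le_trans ?_ (eLpNorm_add_le_ofReal integrable_condExp.aestronglyMeasurable
    (Finset.aestronglyMeasurable_sum _ hFm) (by positivity) (by positivity) hD hFs)
  -- Domination needs no measurability of the supremum, which is not available for arbitrary
  -- minimisers.
  refine eLpNorm_mono_enorm_ae ?_
  have hHall : ∀ᵐ ω ∂μ, ∀ j ∈ s₀, |trunc R (ψ i j ω (I (timeGrid T N i) ω)) -
        φ (timeGrid T N i) (timeGrid T N j) (I (timeGrid T N i) ω)| ≤ H j ω :=
    (Finset.eventually_all _).2 fun j hj => hHb j (hmem j hj).1 (hmem j hj).2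
  filter_upwards [hA.ae_abs_condSignal_sub_le hT hϑ hL hY hN ht, hHall] with ω h1 h2
  rw [enorm_eq_self]
  refine iSup₂_le fun s hs => ?_
  rw [enorm_le_iff_norm_le, Real.norm_eq_abs, Real.norm_eq_abs]
  refine le_trans ?_ (le_abs_self _)
  rw [integral_regressionProcess hT.le hi R I ψ hti]
  set h : ℕ → ℝ := fun j => trunc R (ψ i j ω (I (timeGrid T N i) ω)) with hh
  set G : ℕ → ℝ := fun j => (μ[I (timeGrid T N j) | ℱ t]) ω with hG
  have e : Y t s ω - (A t ω + ∑ j ∈ Finset.range N, gridWeight T N t s j * h j) =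
      (Y t s ω - A t ω - ∑ j ∈ Finset.range N, gridWeight T N t s j * G j) +
        ∑ j ∈ Finset.range N, gridWeight T N t s j * (G j - h j) := by
    simp_rw [mul_sub]
    rw [Finset.sum_sub_distrib]
    ring
  rw [e]
  refine (abs_add_le _ _).trans (add_le_add (h1 s hs) ?_)
  rw [Finset.sum_apply, hs₀, Finset.sum_filter]
  refine (Finset.abs_sum_le_sum_abs _ _).trans (Finset.sum_le_sum fun j hj => ?_)
  split_ifs with hij
  · rw [abs_mul, abs_of_nonneg (gridWeight_nonneg T N hs.1 j)]
    refine mul_le_mul (gridWeight_le hT.le N hs.1 j) ?_ (abs_nonneg _) hTN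
    have h3 := h2 j (Finset.mem_filter.2 ⟨hj, hij⟩)
    rw [abs_sub_comm] at h3
    exact (abs_sub_le _ _ _).trans (add_le_add le_rfl h3)
  -- Grid intervals with `j < i` end before `t`; no estimate is defined for them and none is needed.
  · rw [gridWeight_eq_zero N hs.1 (Or.inl
      ((monotone_timeGrid hT.le N (by omega : j + 1 ≤ i)).trans hti.1)), zero_mul, abs_zero]

/-- This bound has `K / M` without the logarithm and is stronger than the stated one. The constant
is taken positive because the case `R = 0` of the theorem needs it. -/
theorem estimationError_le {μ : Measure Ω} [IsProbabilityMeasure μ] {T ϑ L : ℝ}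
    (hT : 0 < T) (hϑ : 2 < ϑ) (hL : 0 ≤ L) {ℱ : Filtration ℝ mΩ} {A I : ℝ → Ω → ℝ}
    (hA : IsRegularSignal T ϑ L μ ℱ A I) {Ic : ℕ → ℝ → Ω → ℝ} (hIc : IsIndepCopies T μ I Ic) :
    ∃ C : ℝ, 0 < C ∧ ∀ Y : ℝ → ℝ → Ω → ℝ, IsCondSignal T μ ℱ A Y →
      ∀ N M K : ℕ, 0 < N → 0 < M → 0 < K → ∀ R : ℝ, 0 < R →
      ∀ ψ : ℕ → ℕ → Ω → ℝ → ℝ, IsRegression T N M K R Ic ψ →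
        estimationError T μ N R A I Y ψ ≤
          ENNReal.ofReal (C * (1 / √(N : ℝ) + R * √(K / M) + R / K + R ^ (-((ϑ - 2) / 2)))) := by
  obtain ⟨b, c, hb, hc, hmom⟩ := hA.exists_moment_bound hϑ
  obtain ⟨φ, hφ, hφL⟩ := hA.transition
  set C₁ := T * L * √T + T * (L * (L + 1 + 2 * c) * √T) with hC₁
  set C₂ := T * (√b + √((2 ^ ϑ + 1) * b)) with hC₂
  have hC₁0 : 0 ≤ C₁ := by positivity
  have hC₂0 : 0 ≤ C₂ := by positivity
  refine ⟨C₁ + 2 * T + T * L + C₂, by positivity, ?_⟩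
  intro Y hY N M K hN hM hK R hR ψ hψ
  refine iSup₂_le fun t ht => ?_
  -- The final time lies in no grid interval. There only `s = t` remains, the integral is empty, and
  -- the error vanishes since the signal is its own conditional expectation.
  rcases ht.2.eq_or_lt with rfl | htT
  · have h0 : (fun ω => ⨆ s ∈ Icc t t,
        ‖Y t s ω - (A t ω + ∫ r in t..s, regressionProcess t N R I ψ t r ω)‖ₑ) =ᵐ[μ] fun _ => 0 := by
      filter_upwards [hY.ae_eq t ht t ⟨le_rfl, le_rfl⟩, hA.condExp_signal_self hT hϑ hL ht]
        with ω h1 h2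
      refine le_antisymm (iSup₂_le fun s hs => ?_) zero_le
      obtain rfl : s = t := le_antisymm hs.2 hs.1
      simp [h1, h2]
    rw [eLpNorm_congr_ae h0, eLpNorm_zero']
    exact zero_le
  · obtain ⟨i, hi, hti⟩ := exists_mem_timeGrid hT hN ht.1 htT
    have hR' : 0 < R ^ (-((ϑ - 2) / 2)) := Real.rpow_pos_of_pos hR _
    refine (eLpNorm_iSup_le hT hϑ hL hA hY hφ hN ht hi hti (by positivity) (by positivity)
      (fun j hij hj => hA.eLpNorm_condExp_sub_transition_le hT hϑ hL hc
        (fun t ht => (hmom t ht).2.1) hφ hφL hN hij hj ht hti)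
      (fun j hij hj => exists_grid_regression_majorant hT hϑ hL hA hIc hb
        (fun t ht => ⟨(hmom t ht).1, (hmom t ht).2.2⟩) hφ hφL hN hM hK hR hψ hij hj)).trans
      (ENNReal.ofReal_le_ofReal ?_)
    have hs : √(T / N) = √T * (1 / √(N : ℝ)) := by
      rw [Real.sqrt_div hT.le]
      ring
    rw [hs]
    set x₁ := 1 / √(N : ℝ)
    set x₂ := R * √(K / M) with hx₂
    set x₃ := R / (K : ℝ)
    set x₄ := R ^ (-((ϑ - 2) / 2))
    have p₁ : 0 ≤ x₁ := by positivity
    have p₂ : 0 ≤ x₂ := by positivity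
    have p₃ : 0 ≤ x₃ := by positivity
    have p₄ : 0 ≤ x₄ := by positivity
    have e : T * (L * (√T * x₁)) + T * (L * (L + 1 + 2 * c) * (√T * x₁) +
        (2 * R * √(K / M) + L * x₃ + (√b + √((2 ^ ϑ + 1) * b)) * x₄)) =
        C₁ * x₁ + 2 * T * x₂ + T * L * x₃ + C₂ * x₄ := by
      rw [hC₁, hC₂, hx₂]
      ring
    rw [e]
    have hTL : 0 ≤ T * L := by positivity
    have q : ∀ a x : ℝ, 0 ≤ x → a ≤ C₁ + 2 * T + T * L + C₂ →
        a * x ≤ (C₁ + 2 * T + T * L + C₂) * x := fun a x hx ha => mul_le_mul_of_nonneg_right ha hx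
    have q₁ := q C₁ x₁ p₁ (by linarith)
    have q₂ := q (2 * T) x₂ p₂ (by linarith)
    have q₃ := q (T * L) x₃ p₃ (by linarith)
    have q₄ := q C₂ x₄ p₄ (by linarith)
    linarith

end LSMC

namespace LSMC

/-! ### Tuned parameters -/

/-- Real numbers strictly between `0` and the liminf, and strictly above the limsup, serve as
constants. The bounds hold only eventually. -/
theorem SameOrder.exists_bounds {a b : ℕ → ℝ} (hb : ∀ M, 0 < M → 0 < b M) (h : SameOrder a b) :
    ∃ c d : ℝ, 0 < c ∧ 0 < d ∧ ∀ᶠ M in atTop, c * b M ≤ a M ∧ a M ≤ d * b M := by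
  obtain ⟨c, -, hc, hc'⟩ := ENNReal.lt_iff_exists_real_btwn.1 h.1
  obtain ⟨d, -, hd, -⟩ := ENNReal.lt_iff_exists_real_btwn.1 h.2
  have hc0 : 0 < c := ENNReal.ofReal_pos.1 hc
  have hd0 : 0 < d := ENNReal.ofReal_pos.1 (zero_le.trans_lt hd)
  refine ⟨c, d, hc0, hd0, ?_⟩
  filter_upwards [eventually_lt_of_lt_liminf hc', eventually_lt_of_limsup_lt hd,
    eventually_gt_atTop 0] with M h1 h2 hM
  have hbM := hb M hM
  constructor
  · have := (ENNReal.ofReal_lt_ofReal_iff_of_nonneg hc0.le).1 h1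
    exact ((lt_div_iff₀ hbM).1 this).le
  · have := (ENNReal.ofReal_lt_ofReal_iff hd0).1 h2
    exact ((div_lt_iff₀ hbM).1 this).le

/-- With `x = M / (log M + 1)`, the second and third terms have order `x ^ (2 / (3 * ϑ) - 1 / 3)`,
which is the rate; the tail term has the same exponent. The first term has order `x ^ (-1 / 3)`,
which is smaller because `1 ≤ x`. In the second term `m` is simply replaced by the smaller `x`. -/
theorem tuned_rate_le {ϑ x m n k R c₁ c₂ d₂ c₃ d₃ : ℝ} (hϑ : 2 < ϑ) (hx : 1 ≤ x) (hm : x ≤ m)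
    (hc₁ : 0 < c₁) (hc₂ : 0 < c₂) (hd₂ : 0 < d₂) (hc₃ : 0 < c₃) (hd₃ : 0 < d₃)
    (hn : c₁ * x ^ (2 / 3 : ℝ) ≤ n) (hk : c₂ * x ^ (1 / 3 : ℝ) ≤ k) (hk' : k ≤ d₂ * x ^ (1 / 3 : ℝ))
    (hR : c₃ * x ^ (2 / (3 * ϑ)) ≤ R) (hR' : R ≤ d₃ * x ^ (2 / (3 * ϑ))) :
    1 / √n + R * √(k / m) + R / k + R ^ (-((ϑ - 2) / 2)) ≤
      (1 / √c₁ + d₃ * √d₂ + d₃ / c₂ + c₃ ^ (-((ϑ - 2) / 2))) * x ^ (-((ϑ - 2) / (3 * ϑ))) := by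
  have hx0 : 0 < x := by linarith
  have hϑ0 : 0 < ϑ := by linarith
  have hR0 : 0 < R := lt_of_lt_of_le (by positivity) hR
  have hk0 : 0 < k := lt_of_lt_of_le (by positivity) hk
  have e : 2 / (3 * ϑ) - 1 / 3 = -((ϑ - 2) / (3 * ϑ)) := by
    field_simp
    ring
  have t₁ : 1 / √n ≤ 1 / √c₁ * x ^ (-((ϑ - 2) / (3 * ϑ))) := by
    have h1 : √c₁ * x ^ (1 / 3 : ℝ) ≤ √n := by
      refine Real.le_sqrt_of_sq_le (le_trans (le_of_eq ?_) hn)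
      rw [mul_pow, Real.sq_sqrt hc₁.le, ← Real.rpow_natCast, ← Real.rpow_mul hx0.le]
      norm_num
    have h2 : 1 / √n ≤ 1 / (√c₁ * x ^ (1 / 3 : ℝ)) :=
      one_div_le_one_div_of_le (by positivity) h1
    refine h2.trans ?_
    rw [one_div_mul_eq_div, div_mul_eq_div_div, div_eq_mul_inv (1 / √c₁), ← Real.rpow_neg hx0.le,
      one_div_mul_eq_div]
    refine div_le_div_of_nonneg_right (Real.rpow_le_rpow_of_exponent_le hx ?_) (Real.sqrt_nonneg _)
    rw [← e]
    have : 0 ≤ 2 / (3 * ϑ) := by positivity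
    linarith
  have t₂ : R * √(k / m) ≤ d₃ * √d₂ * x ^ (-((ϑ - 2) / (3 * ϑ))) := by
    have h1 : √(k / m) ≤ √d₂ * x ^ (-(1 / 3) : ℝ) := by
      refine Real.sqrt_le_iff.2 ⟨by positivity, ?_⟩
      rw [mul_pow, Real.sq_sqrt hd₂.le, ← Real.rpow_natCast, ← Real.rpow_mul hx0.le]
      calc k / m ≤ (d₂ * x ^ (1 / 3 : ℝ)) / x := div_le_div₀ (by positivity) hk' hx0 hm
        _ = d₂ * (x ^ (1 / 3 : ℝ) * x ^ (-1 : ℝ)) := by rw [Real.rpow_neg_one]; ring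
        _ = _ := by rw [← Real.rpow_add hx0]; norm_num
    calc R * √(k / m) ≤ (d₃ * x ^ (2 / (3 * ϑ))) * (√d₂ * x ^ (-(1 / 3) : ℝ)) :=
          mul_le_mul hR' h1 (Real.sqrt_nonneg _) (by positivity)
      _ = d₃ * √d₂ * (x ^ (2 / (3 * ϑ)) * x ^ (-(1 / 3) : ℝ)) := by ring
      _ = _ := by rw [← Real.rpow_add hx0, ← e, sub_eq_add_neg]
  have t₃ : R / k ≤ d₃ / c₂ * x ^ (-((ϑ - 2) / (3 * ϑ))) := by
    calc R / k ≤ (d₃ * x ^ (2 / (3 * ϑ))) / (c₂ * x ^ (1 / 3 : ℝ)) :=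
          div_le_div₀ (by positivity) hR' (by positivity) hk
      _ = d₃ / c₂ * (x ^ (2 / (3 * ϑ)) / x ^ (1 / 3 : ℝ)) := by ring
      _ = _ := by rw [← Real.rpow_sub hx0, e]
  have t₄ : R ^ (-((ϑ - 2) / 2)) ≤ c₃ ^ (-((ϑ - 2) / 2)) * x ^ (-((ϑ - 2) / (3 * ϑ))) := by
    refine (Real.rpow_le_rpow_of_nonpos (by positivity) hR (by linarith)).trans_eq ?_
    rw [Real.mul_rpow hc₃.le (by positivity), ← Real.rpow_mul hx0.le]
    congr 2
    field_simp
  linarith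

end LSMC

/-! ### The theorem -/

theorem mainTheorem7 {Ω : Type*} [mΩ : MeasurableSpace Ω]
    (μ : Measure Ω) [IsProbabilityMeasure μ]
    (T : ℝ) (hT : 0 < T) (ℱ : Filtration ℝ mΩ)
    (ϑ L : ℝ) (hϑ : 2 < ϑ) (hL : 0 ≤ L)
    (A I : ℝ → Ω → ℝ) (hA : LSMC.IsRegularSignal T ϑ L μ ℱ A I)
    (Ic : ℕ → ℝ → Ω → ℝ) (hIc : LSMC.IsIndepCopies T μ I Ic) :
    -- a path-continuous version of the conditional expectations exists
    (∃ Y : ℝ → ℝ → Ω → ℝ, LSMC.IsCondSignal T μ ℱ A Y) ∧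
    -- the error bound for all parameters
    (∃ C : ℝ, 0 ≤ C ∧ ∀ Y : ℝ → ℝ → Ω → ℝ, LSMC.IsCondSignal T μ ℱ A Y →
      ∀ N M K : ℕ, 0 < N → 0 < M → 0 < K → ∀ R : ℝ, 0 ≤ R →
      ∀ ψ : ℕ → ℕ → Ω → ℝ → ℝ, LSMC.IsRegression T N M K R Ic ψ →
        LSMC.estimationError T μ N R A I Y ψ ≤
          ENNReal.ofReal C *
            (ENNReal.ofReal
                (1 / √(N : ℝ) + R * √((Real.log M + 1) * K / M) + R / K)
              + (ENNReal.ofReal R) ^ (-((ϑ - 2) / 2)))) ∧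
    -- the convergence rate for tuned parameters
    (∀ (N K : ℕ → ℕ) (R : ℕ → ℝ), (∀ M, 0 < M → 0 < N M ∧ 0 < K M ∧ 0 < R M) →
      LSMC.SameOrder (fun M => (N M : ℝ))
        (fun M => ((M : ℝ) / (Real.log M + 1)) ^ (2 / 3 : ℝ)) →
      LSMC.SameOrder (fun M => (K M : ℝ))
        (fun M => ((M : ℝ) / (Real.log M + 1)) ^ (1 / 3 : ℝ)) →
      LSMC.SameOrder R
        (fun M => ((M : ℝ) / (Real.log M + 1)) ^ (2 / (3 * ϑ))) →
      ∃ C : ℝ, 0 ≤ C ∧ ∀ Y : ℝ → ℝ → Ω → ℝ, LSMC.IsCondSignal T μ ℱ A Y →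
        ∀ M : ℕ, 0 < M →
        ∀ ψ : ℕ → ℕ → Ω → ℝ → ℝ, LSMC.IsRegression T (N M) M (K M) (R M) Ic ψ →
          LSMC.estimationError T μ (N M) (R M) A I Y ψ ≤
            ENNReal.ofReal (C * ((Real.log M + 1) / M) ^ ((ϑ - 2) / (3 * ϑ)))) := by
  obtain ⟨C, hC, hCb⟩ := LSMC.estimationError_le hT hϑ hL hA hIc
  refine ⟨hA.exists_isCondSignal hT hϑ, ⟨C, hC.le, ?_⟩, ?_⟩
  · intro Y hY N M K hN hM hK R hR ψ hψ
    rcases hR.eq_or_lt with rfl | hR0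
    -- For `R = 0` the right-hand side is infinite; positivity of `C` excludes the product `0 * ⊤ =
    -- 0`.
    · rw [ENNReal.ofReal_zero, ENNReal.zero_rpow_of_neg (by linarith), add_top,
        ENNReal.mul_top (by simpa using hC)]
      exact le_top
    · refine (hCb Y hY N M K hN hM hK R hR0 ψ hψ).trans ?_
      have hlog : 0 ≤ Real.log M := Real.log_natCast_nonneg M
      rw [ENNReal.ofReal_rpow_of_pos hR0, ← ENNReal.ofReal_add (by positivity) (by positivity),
        ← ENNReal.ofReal_mul hC.le]
      refine ENNReal.ofReal_le_ofReal (mul_le_mul_of_nonneg_left ?_ hC.le)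
      gcongr
      -- The factor `log M + 1` is at least 1, so inserting it only weakens the bound.
      exact le_mul_of_one_le_left (by positivity) (by linarith)
  · intro N K R hpos hN hK hR
    set x : ℕ → ℝ := fun M => (M : ℝ) / (Real.log M + 1) with hx
    have hlog : ∀ M : ℕ, 0 < Real.log M + 1 := fun M => by
      have := Real.log_natCast_nonneg M
      linarith
    have hx0 : ∀ M, 0 < M → 0 < x M := fun M hM => by
      have := hlog M
      positivity
    have hx1 : ∀ M, 0 < M → 1 ≤ x M := fun M hM => by
      rw [hx, one_le_div (hlog M)]
      have := Real.log_le_sub_one_of_pos (show (0 : ℝ) < M by exact_mod_cast hM)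
      linarith
    have hxM : ∀ M : ℕ, x M ≤ M := fun M => by
      refine div_le_self M.cast_nonneg ?_
      have := Real.log_natCast_nonneg M
      linarith
    obtain ⟨c₁, d₁, hc₁, -, h₁⟩ := hN.exists_bounds fun M hM => Real.rpow_pos_of_pos (hx0 M hM) _
    obtain ⟨c₂, d₂, hc₂, hd₂, h₂⟩ := hK.exists_bounds fun M hM => Real.rpow_pos_of_pos (hx0 M hM) _
    obtain ⟨c₃, d₃, hc₃, hd₃, h₃⟩ := hR.exists_bounds fun M hM => Real.rpow_pos_of_pos (hx0 M hM) _
    set g : ℕ → ℝ := fun M =>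
      1 / √(N M : ℝ) + R M * √(K M / M) + R M / K M + R M ^ (-((ϑ - 2) / 2)) with hg
    set C' := 1 / √c₁ + d₃ * √d₂ + d₃ / c₂ + c₃ ^ (-((ϑ - 2) / 2)) with hC'
    have hC'0 : 0 ≤ C' := by positivity
    have hev : ∀ᶠ M in atTop, g M ≤ C' * x M ^ (-((ϑ - 2) / (3 * ϑ))) := by
      filter_upwards [h₁, h₂, h₃, eventually_gt_atTop 0] with M k₁ k₂ k₃ hM
      exact LSMC.tuned_rate_le hϑ (hx1 M hM) (hxM M) hc₁ hc₂ hd₂ hc₃ hd₃ k₁.1 k₂.1 k₂.2 k₃.1 k₃.2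
    obtain ⟨M₀, hM₀⟩ := eventually_atTop.1 hev
    -- The finitely many `M` before the asymptotic bounds take effect are absorbed by adding all
    -- their ratios to the constant.
    set S := ∑ M ∈ Finset.range M₀, |g M / x M ^ (-((ϑ - 2) / (3 * ϑ)))| with hS
    have hS0 : 0 ≤ S := Finset.sum_nonneg fun _ _ => abs_nonneg _
    have hall : ∀ M, 0 < M → g M ≤ (C' + S) * x M ^ (-((ϑ - 2) / (3 * ϑ))) := fun M hM => by
      have hr : 0 < x M ^ (-((ϑ - 2) / (3 * ϑ))) := Real.rpow_pos_of_pos (hx0 M hM) _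
      rcases le_or_gt M₀ M with h | h
      · exact (hM₀ M h).trans (mul_le_mul_of_nonneg_right (by linarith) hr.le)
      · rw [← div_le_iff₀ hr]
        have h1 := Finset.single_le_sum
          (f := fun M => |g M / x M ^ (-((ϑ - 2) / (3 * ϑ)))|) (fun _ _ => abs_nonneg _)
          (Finset.mem_range.2 h)
        have h2 := le_abs_self (g M / x M ^ (-((ϑ - 2) / (3 * ϑ))))
        linarith
    refine ⟨C * (C' + S), by positivity, fun Y hY M hM ψ hψ => ?_⟩
    obtain ⟨hNM, hKM, hRM⟩ := hpos M hM
    refine (hCb Y hY (N M) M (K M) hNM hM hKM (R M) hRM ψ hψ).trans (ENNReal.ofReal_le_ofReal ?_)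
    have e : ((Real.log M + 1) / M) ^ ((ϑ - 2) / (3 * ϑ)) = x M ^ (-((ϑ - 2) / (3 * ϑ))) := by
      rw [Real.rpow_neg (hx0 M hM).le, ← Real.inv_rpow (hx0 M hM).le, hx, inv_div]
    rw [e, mul_assoc]
    exact mul_le_mul_of_nonneg_left (hall M hM) hC.le
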